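/- **Setting.** Let $d\ge 1$; inequalities between vectors are componentwise and $\mathbb R_+=[0,\infty)$. For $m,j\in\{1,\dots,d\}$ let $g_{mj}:\mathbb R_+\to\mathbb R_+$ be non-increasing and integrable, $c_{mj}=\int_0^\infty g_{mj}(v)\,dv$, and let $B_j=(B_{1j},\dots,B_{dj})$ be a random vector in $\mathbb R_+^d$. Assume that (i) the matrix $H=(h_{mj})$, $h_{mj}=\mathbb E[B_{mj}]c_{mj}$, has spectral radius $<1$; (ii) for some $\vartheta\in(0,\infty)^d$, $\mathbb E[\exp(\sum_m B_{mj}\vartheta_m)]<\infty$ for all $j$. Consider the cluster of the associated multivariate Hawkes process started by an immigrant in component $j$: every event in a component $i$ receives an independent mark vector distributed as $B_i$ and, given this mark, produces children in the components $m=1,\dots,d$ according to independent Poisson processes of intensity $B_{mi}\,g_{mi}(\cdot)$, time being counted from its own occurrence; the cluster consists of the immigrant and all its descendants. Let $S_{l\leftarrow j}$ be the total number of its events in component $l$ (including the immigrant if $l=j$), $$f_j(z)=\mathbb E\Big[\prod_{l=1}^d z_l^{S_{l\leftarrow j}}\Big]\in[0,\infty],\qquad z\in\mathbb R_+^d ,$$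 $f=(f_1,\dots,f_d)$, and let $\mathscr D_f=\{z\in\mathbb R_+^d: f_j(z)<\infty\text{ for all }j\}$. For $r\in(0,\infty)^d$ call $\hat x\in\mathbb R^d$ a solution for $r$ if, for all $j$, all expectations in $$\hat x_j\sum_{k=1}^d r_k\,\mathbb E\Big[B_{kj}c_{kj}e^{\sum_m B_{mj}c_{mj}(\hat x_m-1)}\Big]=r_j\,\mathbb E\Big[e^{\sum_m B_{mj}c_{mj}(\hat x_m-1)}\Big]$$ are finite and the equation holds; the point $\hat z=\hat z(r,\hat x)$ is then given by $$\hat z_j=r_j\Big(\sum_{k=1}^d r_k\,\mathbb E\Big[B_{kj}c_{kj}e^{\sum_m B_{mj}c_{mj}(\hat x_m-1)}\Big]\Big)^{-1}.$$ **Proposition.** The sizes $S_{l\leftarrow j}$ are almost surely finite, and the following hold. (a) Let $r\in(0,\infty)^d$, let $\hat x$ be a solution for $r$, and $\hat z=\hat z(r,\hat x)$. Then $\{0\le z\le\hat z\}\subseteq\mathscr D_f$, and on $\{0\le z\le\hat z\}$ the function $f$ is increasing (that is, $z\le z'$ implies $f(z)\le f(z')$) and satisfies $$f_j(z)=z_j\,\mathbb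 E\Big[\exp\Big(\sum_{m=1}^d B_{mj}c_{mj}(f_m(z)-1)\Big)\Big],\qquad j=1,\dots,d,\tag{1}$$ with finite expectations. It is the only increasing $\mathbb R^d$-valued function that satisfies (1) on $\{z\ge0: z_j<\hat z_j\text{ for all }j\}$ and, if $H$ is irreducible, the only one that satisfies (1) on $\{0\le z\le\hat z\}$. Moreover $f(\hat z)=\hat x$, the point $\hat z$ lies on the boundary of $\mathscr D_f$, and no $z$ with $z_j>\hat z_j$ for all $j$ belongs to $\mathscr D_f$; if $H$ is irreducible, then $z\in\mathscr D_f$ and $z\ge\hat z$ imply $z=\hat z$. (b) Suppose that $H$ is irreducible and that the sets $\{\vartheta\in\mathbb R^d:\mathbb E[\exp(\sum_m B_{mj}\vartheta_m)]<\infty\}$, $j=1,\dots,d$, are open (for instance, all of $\mathbb R^d$). Then a point $z\in(0,\infty)^d$ belongs to $\mathscr D_f$ if and only if $z\le\hat z(r,\hat x)$ for some $r\in(0,\infty)^d$ and some solution $\hat x$ for $r$; and it belongs to the boundary of $\mathscr D_f$ if and only if $z=\hat z(r,\hat x)$ for some such $r$ and $\hat x$. Here $H$ is irreducible if for all $i,j$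 there is $k\ge1$ with $(H^k)_{ij}>0$. -/

import Mathlib

open MeasureTheory ProbabilityTheory
open scoped ENNReal NNReal

namespace Hawkes

/-- The ingredients of a `d`-variate Hawkes process that govern its clusters: the decay functions
`g m j` (excitation of component `m` by an event in component `j`), which are non-negative,
non-increasing and integrable on the half line, and the law `markLaw j` of the non-negative random
mark vector `B_j = (B_{1j}, …, B_{dj})` attached to an event in component `j`. -/
structure Model (d : ℕ) where
  g : Fin d → Fin d → ℝ → ℝ
  g_nonneg : ∀ m j t, 0 ≤ t → 0 ≤ g m j t
  g_antitone : ∀ m j, AntitoneOn (g m j) (Set.Ici 0)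
  g_integrable : ∀ m j, IntegrableOn (g m j) (Set.Ioi 0)
  markLaw : Fin d → Measure (Fin d → ℝ≥0)
  markLaw_prob : ∀ j, IsProbabilityMeasure (markLaw j)

/-- Labels of the potential events of a cluster: the root (the immigrant) is `[]`, and
`(m, n) :: ν` is the `n`-th potential child in component `m` of the event `ν`. -/
abbrev Node (d : ℕ) : Type := List (Fin d × ℕ)

/-- The component of an event, in a cluster whose immigrant is in component `j`. -/
def nodeType {d : ℕ} (j : Fin d) : Node d → Fin d
  | [] => j
  | (m, _) :: _ => m

/-- The random data of a cluster: the mark of every potential event `ν`, and the delay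
`delay ν ω m n` after which its `n`-th child in component `m` is born; the value `∞` means that
this child does not exist. -/
structure ClusterData (d : ℕ) (Ω : Type*) where
  mark : Node d → Ω → Fin d → ℝ≥0
  delay : Node d → Ω → Fin d → ℕ → ℝ≥0∞

/-- The number of children with (component, delay) in `A`. -/
noncomputable def childCount {d : ℕ} (T : Fin d → ℕ → ℝ≥0∞) (A : Set (Fin d × ℝ)) : ℕ∞ :=
  {p : Fin d × ℕ | T p.1 p.2 ≠ ⊤ ∧ (p.1, (T p.1 p.2).toReal) ∈ A}.encard

namespace Model

variable {d : ℕ} (M : Model d)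

/-- The intensity measure, evaluated at `A`, of the children of an event in component `j` with
mark vector `b`: into component `m` it has density `b m * g m j t` on `(0, ∞)`. -/
noncomputable def intensity (j : Fin d) (b : Fin d → ℝ≥0) (A : Set (Fin d × ℝ)) : ℝ≥0∞ :=
  ∑ m, (b m : ℝ≥0∞) * ∫⁻ t in {t : ℝ | 0 < t ∧ (m, t) ∈ A}, ENNReal.ofReal (M.g m j t)

/-- `D` is a cluster of the Hawkes process with an immigrant in component `j`: the data of
different events are independent; the mark of an event in component `i` has law `markLaw i`; and,
given its mark `b`, the children of such an event form independent Poisson processes, the one into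
component `m` having intensity `b m * g m i`. (The counts of children in pairwise disjoint sets are
conditionally independent and Poisson, with means given by the intensity measure.) -/
structure IsCluster {Ω : Type*} [MeasurableSpace Ω] (μ : Measure Ω) (j : Fin d)
    (D : ClusterData d Ω) : Prop where
  measurable_mark : ∀ ν, Measurable (D.mark ν)
  measurable_delay : ∀ ν, Measurable (D.delay ν)
  indep : iIndepFun (fun ν ω => (D.mark ν ω, D.delay ν ω)) μ
  map_mark : ∀ ν, μ.map (D.mark ν) = M.markLaw (nodeType j ν)
  poisson : ∀ (ν : Node d) (E : Set (Fin d → ℝ≥0)), MeasurableSet E →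
    ∀ (n : ℕ) (A : Fin n → Set (Fin d × ℝ)), (∀ i, MeasurableSet (A i)) →
      Pairwise (fun i i' => Disjoint (A i) (A i')) → ∀ k : Fin n → ℕ,
      μ {ω | D.mark ν ω ∈ E ∧ ∀ i, childCount (D.delay ν ω) (A i) = (k i : ℕ∞)} =
        ∫⁻ b in E, ∏ i, poissonMeasure (M.intensity (nodeType j ν) b (A i)).toNNReal {k i}
          ∂(M.markLaw (nodeType j ν))

end Model

namespace ClusterData

variable {d : ℕ} {Ω : Type*} (D : ClusterData d Ω)

/-- Birth time of an event, the immigrant being born at time `0`; it is `∞` exactly for the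
labels that do not occur in the cluster. -/
noncomputable def birth : Node d → Ω → ℝ≥0∞
  | [], _ => 0
  | (m, n) :: ν, ω => birth ν ω + D.delay ν ω m n

/-- `S_{i←j}(u)`: the number of events of the cluster in component `i` up to time `u`, the
immigrant (in component `j`) included. -/
noncomputable def count (j i : Fin d) (u : ℝ≥0) (ω : Ω) : ℕ∞ :=
  {ν : Node d | nodeType j ν = i ∧ D.birth ν ω ≤ u}.encard

/-- The cluster size `S_{i←j} = lim_{u → ∞} S_{i←j}(u)`, a monotone limit. -/
noncomputable def size (j i : Fin d) (ω : Ω) : ℕ∞ := ⨆ u : ℝ≥0, D.count j i u ω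

end ClusterData

/-- The vector of cluster-size generating functions,
`f_j(z) = E [∏_l z_l ^ S_{l←j}] ∈ [0, ∞]` for `z ≥ 0`; `C j` is a cluster with immigrant in
component `j` (under the stability condition the sizes are almost surely finite). -/
noncomputable def pgf {d : ℕ} {Ω : Type*} [MeasurableSpace Ω] (μ : Measure Ω)
    (C : Fin d → ClusterData d Ω) (z : Fin d → ℝ) (j : Fin d) : ℝ≥0∞ :=
  ∫⁻ ω, ∏ l, ENNReal.ofReal (z l) ^ ((C j).size j l ω).toNat ∂μ

/-- The effective domain of the generating functions. -/
def pgfDomain {d : ℕ} {Ω : Type*} [MeasurableSpace Ω] (μ : Measure Ω)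
    (C : Fin d → ClusterData d Ω) : Set (Fin d → ℝ) :=
  {z | 0 ≤ z ∧ ∀ j, pgf μ C z j < ⊤}

namespace Model

variable {d : ℕ} (M : Model d)

/-- `c_{mj} = ∫_0^∞ g_{mj}(v) dv`. -/
noncomputable def c (m j : Fin d) : ℝ := ∫ t in Set.Ioi 0, M.g m j t

/-- The matrix `H` with entries `h_{mj} = E[B_{mj}] c_{mj}`. -/
noncomputable def H : Matrix (Fin d) (Fin d) ℝ :=
  fun m j => (∫ b, (b m : ℝ) ∂(M.markLaw j)) * M.c m j

/-- The stability condition: `H` has spectral radius (largest modulus of a complex eigenvalue)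
smaller than one. -/
def Stable : Prop := spectralRadius ℂ (M.H.map (fun a : ℝ => (a : ℂ))) < 1

/-- The marks `B_j` have a finite moment generating function at `ϑ`. -/
def MgfFinite (j : Fin d) (ϑ : Fin d → ℝ) : Prop :=
  Integrable (fun b : Fin d → ℝ≥0 => Real.exp (∑ m, (b m : ℝ) * ϑ m)) (M.markLaw j)

/-- `exp (∑_m B_{mj} c_{mj} (x_m - 1))` as a function of the value `b` of `B_j`. -/
noncomputable def weight (j : Fin d) (x : Fin d → ℝ) (b : Fin d → ℝ≥0) : ℝ :=
  Real.exp (∑ m, (b m : ℝ) * M.c m j * (x m - 1))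

/-- On `s`, the function `h` solves the fixed-point system
`h_j(z) = z_j E[exp (∑_m B_{mj} c_{mj} (h_m(z) - 1))]`, all expectations being finite. -/
def IsFixedPointOn (h : (Fin d → ℝ) → Fin d → ℝ) (s : Set (Fin d → ℝ)) : Prop :=
  ∀ z ∈ s, ∀ j, Integrable (M.weight j (h z)) (M.markLaw j) ∧
    h z j = z j * ∫ b, M.weight j (h z) b ∂(M.markLaw j)

/-- `∑_k r_k E[B_{kj} c_{kj} exp (∑_m B_{mj} c_{mj} (x_m - 1))]`. -/
noncomputable def tilt (r x : Fin d → ℝ) (j : Fin d) : ℝ :=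
  ∑ k, r k * ∫ b, (b k : ℝ) * M.c k j * M.weight j x b ∂(M.markLaw j)

/-- `x` solves the system that defines `x̂` for the vector `r`, all expectations in it being
finite. -/
structure IsXHat (r x : Fin d → ℝ) : Prop where
  integrable_weight : ∀ j, Integrable (M.weight j x) (M.markLaw j)
  integrable_mul_weight : ∀ k j,
    Integrable (fun b => (b k : ℝ) * M.c k j * M.weight j x b) (M.markLaw j)
  eq : ∀ j, x j * M.tilt r x j = r j * ∫ b, M.weight j x b ∂(M.markLaw j)

/-- The point `ẑ` belonging to `r` and a solution `x = x̂`. -/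
noncomputable def zHat (r x : Fin d → ℝ) (j : Fin d) : ℝ := r j * (M.tilt r x j)⁻¹

end Model

end Hawkes

/-!
The generating functions `f` of the cluster sizes are the *minimal* non-negative solution of the
fixed-point system `x_j = z_j E exp (∑_m B_{mj} c_{mj} (x_m - 1))`; everything else is convexity of
the exponential function.

*Branching.* `truncProd` is the product of `z` over the events of a family tree, set to `0` if the
tree has too many generations. Since the families of different children are independent
(`Model.IsCluster.lintegral_truncProd`), its expectations are the iterates of the fixed-point map
started at `0`. By monotone convergence `f` is their supremum `Model.minSol`, provided that the
trees are almost surely finite; for `z = 1` the supremum is the vector of extinction probabilities,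
whose complement `y` satisfies `y ≤ y H` by convexity, so that `y = 0` as `H ^ n → 0`
(`Model.minSol_one`). Hence `z` belongs to the domain of `f` as soon as the system has a
supersolution `x ≥ 0` at `z`, and then `f z ≤ x` (`Model.mem_domain_of_supersolution`).

*Critical points.* The pairs `(ẑ, x̂)` are exactly those for which `x̂` solves the system at `ẑ` and
`r` is a left eigenvector, to the eigenvalue one, of the Jacobian matrix of the fixed-point map at
`x̂` (`Model.IsCritical`). Comparing the fixed-point map with its tangent at `x̂`, at a coordinate
where the distance between two solutions has its largest or smallest ratio to `r`, shows that
ordered solutions below `x̂` coincide (`Model.IsCritical.eq_of_le`), and that a solution `x ≥ x̂` at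
some `z ≥ ẑ` agrees with `(ẑ, x̂)` in one coordinate (`Model.IsCritical.exists_coord_eq`), hence in
all of them if `H` is irreducible (`Model.IsCritical.eq_of_ge`). For an increasing
solution, the increment between `z` and `(1 + ε) z` is a strict supersolution of the linearised
system and plays the role of `r` (`Model.eq_of_solution_scaled`).

*The whole boundary.* Under irreducibility the Jacobian matrix at `f z` has a positive left
eigenvector `r` (`exists_pos_left_eigenvector`). An eigenvalue below one makes `f z + s r` a strict
supersolution for small `s > 0`, so that `z` is an interior point of the domain; an eigenvalue above
one would make `f z - s r` a supersolution below the minimal solution; so boundary points of the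
domain are critical (`Model.mem_interior_or_isCritical`). The domain is closed in the open orthant
(`Model.mem_domain_of_smul`) and bounded along rays (`Model.bddAbove_smul_mem_domain`), because the
solutions satisfy `x_j ≥ a z_j x_k ^ 2` whenever `h_{kj} > 0`.
-/

namespace Hawkes

/-! ### Sums over count vectors and Poisson generating functions -/

theorem tsum_prod_fin (n : ℕ) (f : Fin n → ℕ → ℝ≥0∞) :
    ∑' k : Fin n → ℕ, ∏ m, f m (k m) = ∏ m, ∑' k, f m k := by
  induction n with
  | zero => simp
  | succ n ih =>
    rw [Fin.prod_univ_succ, ← ih, ← (Fin.consEquiv (fun _ : Fin (n + 1) => ℕ)).tsum_eq,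
      ENNReal.tsum_prod', ← ENNReal.tsum_mul_right]
    refine tsum_congr fun a => ?_
    rw [← ENNReal.tsum_mul_left]
    refine tsum_congr fun k => ?_
    simp [Fin.prod_univ_succ, Fin.consEquiv]

theorem tsum_pow_mul_poissonMeasure {lam a : ℝ≥0} :
    ∑' k : ℕ, (a : ℝ≥0∞) ^ k * poissonMeasure lam {k} =
      ENNReal.ofReal (Real.exp (lam * ((a : ℝ) - 1))) := by
  have h : ∀ k : ℕ, (a : ℝ≥0∞) ^ k * poissonMeasure lam {k} =
      ENNReal.ofReal (Real.exp (-lam) * ((lam * a : ℝ) ^ k / k.factorial)) := by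
    intro k
    rw [poissonMeasure_singleton, ← ENNReal.ofReal_coe_nnreal,
      ← ENNReal.ofReal_pow (NNReal.coe_nonneg a), ← ENNReal.ofReal_mul (by positivity)]
    congr 1
    rw [mul_pow]
    ring
  simp_rw [h]
  have hs := (NormedSpace.expSeries_div_hasSum_exp ((lam : ℝ) * a)).mul_left (Real.exp (-lam))
  rw [← ENNReal.ofReal_tsum_of_nonneg (fun k => by positivity) hs.summable, hs.tsum_eq,
    ← Real.exp_eq_exp_ℝ, ← Real.exp_add]
  congr 2
  ring

/-! ### Children of an event -/

variable {d : ℕ}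

/-- The labels (component, index) of the children that exist, given the delays. -/
def kids (T : Fin d → ℕ → ℝ≥0∞) : Set (Fin d × ℕ) := {p | T p.1 p.2 ≠ ⊤}

/-- The number of labels in component `m`. -/
def numIn (K : Finset (Fin d × ℕ)) (m : Fin d) : ℕ := (K.filter (fun p => p.1 = m)).card

theorem prod_fst_eq_prod_pow_numIn (a : Fin d → ℝ≥0∞) (K : Finset (Fin d × ℕ)) :
    ∏ p ∈ K, a p.1 = ∏ m, a m ^ numIn K m := by
  rw [← Finset.prod_fiberwise K (fun p => p.1)]
  refine Finset.prod_congr rfl fun m _ => ?_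
  rw [numIn, ← Finset.prod_const]
  exact Finset.prod_congr rfl fun p hp => by rw [(Finset.mem_filter.1 hp).2]

theorem measurableSet_kids_eq (K : Set (Fin d × ℕ)) :
    MeasurableSet {T : Fin d → ℕ → ℝ≥0∞ | kids T = K} := by
  have : {T : Fin d → ℕ → ℝ≥0∞ | kids T = K} =
      ⋂ p : Fin d × ℕ, {T | T p.1 p.2 ≠ ⊤ ↔ p ∈ K} := by
    ext T
    simp [kids, Set.ext_iff]
  rw [this]
  refine MeasurableSet.iInter fun p => ?_
  have hm : MeasurableSet {T : Fin d → ℕ → ℝ≥0∞ | T p.1 p.2 ≠ ⊤} := by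
    have : Measurable fun T : Fin d → ℕ → ℝ≥0∞ => T p.1 p.2 := by fun_prop
    exact this (measurableSet_singleton (⊤ : ℝ≥0∞)).compl
  by_cases hp : p ∈ K
  · simpa [hp] using hm
  · simp only [hp, iff_false]
    exact hm.compl

theorem childCount_component (T : Fin d → ℕ → ℝ≥0∞) (m : Fin d) :
    childCount T {q | q.1 = m} = {p ∈ kids T | p.1 = m}.encard := rfl

theorem childCount_eq_iff (T : Fin d → ℕ → ℝ≥0∞) (k : Fin d → ℕ) :
    (∀ m, childCount T {q | q.1 = m} = (k m : ℕ∞)) ↔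
      ∃ K : Finset (Fin d × ℕ), kids T = K ∧ numIn K = k := by
  constructor
  · intro h
    have hfin : (kids T).Finite := by
      have : kids T = ⋃ m, {p ∈ kids T | p.1 = m} := by ext p; simp
      rw [this]
      refine Set.finite_iUnion fun m => ?_
      rw [← Set.encard_lt_top_iff, ← childCount_component, h]
      exact WithTop.coe_lt_top _
    refine ⟨hfin.toFinset, by simp, ?_⟩
    funext m
    have := h m
    rw [childCount_component] at this
    have e : {p ∈ kids T | p.1 = m} =
        ((hfin.toFinset.filter (fun p => p.1 = m) : Finset _) : Set (Fin d × ℕ)) := by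
      ext p; simp
    rw [e, Set.encard_coe_eq_coe_finsetCard] at this
    exact_mod_cast this
  · rintro ⟨K, hK, rfl⟩ m
    rw [childCount_component, hK]
    have e : {p ∈ (K : Set (Fin d × ℕ)) | p.1 = m} =
        ((K.filter (fun p => p.1 = m) : Finset _) : Set (Fin d × ℕ)) := by
      ext p; simp
    rw [e, Set.encard_coe_eq_coe_finsetCard]
    rfl

namespace Model

variable (M : Model d)

theorem c_nonneg (m j : Fin d) : 0 ≤ M.c m j :=
  setIntegral_nonneg measurableSet_Ioi fun t ht => M.g_nonneg m j t (le_of_lt ht)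

theorem intensity_component (j m : Fin d) (b : Fin d → ℝ≥0) :
    (M.intensity j b {q | q.1 = m}).toNNReal = b m * (M.c m j).toNNReal := by
  have h : M.intensity j b {q | q.1 = m} = (b m : ℝ≥0∞) * ENNReal.ofReal (M.c m j) := by
    rw [intensity, Finset.sum_eq_single m]
    · congr 1
      rw [c, ofReal_integral_eq_lintegral_ofReal (M.g_integrable m j)]
      · simp [Set.Ioi]
      · exact (ae_restrict_iff' measurableSet_Ioi).2
          (Filter.Eventually.of_forall fun t ht => M.g_nonneg m j t (le_of_lt ht))
    · intro m' _ hm'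
      simp [hm']
    · simp
  rw [h]
  simp [ENNReal.toNNReal_mul, ENNReal.ofReal]

/-- The generating function `E ∏_m a_m ^ N_m` of the numbers of children of an event in
component `j`, at a point of `[0, ∞]^d`. -/
noncomputable def offspring (j : Fin d) (a : Fin d → ℝ≥0∞) : ℝ≥0∞ :=
  ∫⁻ b, ∏ m, ∑' k : ℕ, a m ^ k * poissonMeasure (b m * (M.c m j).toNNReal) {k} ∂(M.markLaw j)

/-- The iterates of `a ↦ (z_j · offspring_j (a))_j` started at `0`. -/
noncomputable def iter (z : Fin d → ℝ≥0∞) : ℕ → Fin d → ℝ≥0∞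
  | 0, _ => 0
  | n + 1, j => z j * M.offspring j (iter z n)

theorem offspring_mono (j : Fin d) {a a' : Fin d → ℝ≥0∞} (h : a ≤ a') :
    M.offspring j a ≤ M.offspring j a' := by
  unfold offspring
  gcongr
  exact h _

theorem iter_mono (z : Fin d → ℝ≥0∞) : Monotone (M.iter z) := by
  refine monotone_nat_of_le_succ fun n => ?_
  induction n with
  | zero => intro j; exact zero_le
  | succ n ih => intro j; exact mul_le_mul_right (M.offspring_mono j ih) _

theorem offspring_coe (j : Fin d) (a : Fin d → ℝ≥0) :
    M.offspring j (fun m => (a m : ℝ≥0∞)) =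
      ∫⁻ b, ENNReal.ofReal (M.weight j (fun m => (a m : ℝ)) b) ∂(M.markLaw j) := by
  unfold offspring
  refine lintegral_congr fun b => ?_
  simp_rw [tsum_pow_mul_poissonMeasure]
  rw [← ENNReal.ofReal_prod_of_nonneg (fun _ _ => (Real.exp_pos _).le), ← Real.exp_sum, weight]
  simp [Real.coe_toNNReal _ (M.c_nonneg _ j)]

theorem offspring_one (j : Fin d) : M.offspring j 1 = 1 := by
  have := M.markLaw_prob j
  have h := M.offspring_coe j 1
  simp [weight] at h
  exact h

end Model

/-! ### The law of the set of children -/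

section Cluster

variable {M : Model d} {Ω : Type*} [MeasurableSpace Ω] {μ : Measure Ω} {j : Fin d}
  {D : ClusterData d Ω}

theorem Model.IsCluster.measure_childCount (hD : M.IsCluster μ j D) (ν : Node d) (k : Fin d → ℕ) :
    μ {ω | ∀ m, childCount (D.delay ν ω) {q | q.1 = m} = (k m : ℕ∞)} =
      ∫⁻ b, ∏ m, poissonMeasure (b m * (M.c m (nodeType j ν)).toNNReal) {k m}
        ∂(M.markLaw (nodeType j ν)) := by
  have h := hD.poisson ν Set.univ MeasurableSet.univ d (fun m => {q | q.1 = m})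
    (fun m => measurable_fst (measurableSet_singleton m))
    (fun m m' hm => by
      refine Set.disjoint_left.2 ?_
      rintro q rfl rfl
      exact hm rfl) k
  simpa [M.intensity_component] using h

theorem Model.IsCluster.measurableSet_kids (hD : M.IsCluster μ j D) (ν : Node d)
    (K : Set (Fin d × ℕ)) : MeasurableSet {ω | kids (D.delay ν ω) = K} :=
  hD.measurable_delay ν (measurableSet_kids_eq K)

/-- Given the mark, the numbers of children in the various components are independent Poisson
variables; this computes their joint generating function from the law of the set of children. -/
theorem Model.IsCluster.tsum_kids (hD : M.IsCluster μ j D) (ν : Node d) (a : Fin d → ℝ≥0∞) :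
    ∑' K : Finset (Fin d × ℕ), μ {ω | kids (D.delay ν ω) = K} * ∏ p ∈ K, a p.1 =
      M.offspring (nodeType j ν) a := by
  classical
  have hk : ∀ k : Fin d → ℕ,
      μ {ω | ∀ m, childCount (D.delay ν ω) {q | q.1 = m} = (k m : ℕ∞)} =
        ∑' K : Finset (Fin d × ℕ), if numIn K = k then μ {ω | kids (D.delay ν ω) = K} else 0 := by
    intro k
    have : {ω | ∀ m, childCount (D.delay ν ω) {q | q.1 = m} = (k m : ℕ∞)} =
        ⋃ K : Finset (Fin d × ℕ), {ω | numIn K = k ∧ kids (D.delay ν ω) = K} := by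
      ext ω
      simp only [Set.mem_ofPred_eq, childCount_eq_iff, Set.mem_iUnion]
      exact exists_congr fun K => and_comm
    rw [this, measure_iUnion]
    · refine tsum_congr fun K => ?_
      by_cases h : numIn K = k <;> simp [h]
    · intro K K' hK
      rw [Function.onFun, Set.disjoint_left]
      rintro ω ⟨_, h⟩ ⟨_, h'⟩
      exact hK (Finset.coe_injective (h.symm.trans h'))
    · intro K
      by_cases h : numIn K = k
      · simpa [h] using hD.measurableSet_kids ν K
      · simp [h]
  have hmeas : ∀ (m : Fin d) (k : ℕ), Measurable fun b : Fin d → ℝ≥0 =>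
      poissonMeasure (b m * (M.c m (nodeType j ν)).toNNReal) {k} := by
    intro m k
    simp_rw [poissonMeasure_singleton]
    fun_prop
  calc _ = ∑' K : Finset (Fin d × ℕ), ∑' k : Fin d → ℕ, (∏ m, a m ^ k m) *
          (if numIn K = k then μ {ω | kids (D.delay ν ω) = K} else 0) := by
        refine tsum_congr fun K => ?_
        rw [tsum_eq_single (numIn K), prod_fst_eq_prod_pow_numIn]
        · simp [mul_comm]
        · intro k hk'
          simp [hk'.symm]
    _ = ∑' k : Fin d → ℕ, (∏ m, a m ^ k m) *
          ∫⁻ b, ∏ m, poissonMeasure (b m * (M.c m (nodeType j ν)).toNNReal) {k m}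
            ∂(M.markLaw (nodeType j ν)) := by
        rw [ENNReal.tsum_comm]
        refine tsum_congr fun k => ?_
        rw [ENNReal.tsum_mul_left, ← hk, hD.measure_childCount]
    _ = _ := by
        unfold Model.offspring
        have hm : ∀ k : Fin d → ℕ, Measurable fun b : Fin d → ℝ≥0 =>
            ∏ m, poissonMeasure (b m * (M.c m (nodeType j ν)).toNNReal) {k m} :=
          fun k => Finset.measurable_prod _ fun m _ => hmeas m (k m)
        simp_rw [← tsum_prod_fin, Finset.prod_mul_distrib]
        rw [lintegral_tsum fun k => ((hm k).const_mul _).aemeasurable]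
        exact tsum_congr fun k => (lintegral_const_mul _ (hm k)).symm

/-! ### Products over truncated clusters and their expectations -/

open Classical in
/-- The product of `z` over the components of the event `ν` and its descendants if the family tree
of `ν` has fewer than `n` generations, and `0` otherwise; `T` holds the delays of all nodes. -/
noncomputable def truncProd (z : Fin d → ℝ≥0∞) (j : Fin d) (T : Node d → Fin d → ℕ → ℝ≥0∞) :
    ℕ → Node d → ℝ≥0∞
  | 0, _ => 0
  | n + 1, ν => z (nodeType j ν) * ∑' K : Finset (Fin d × ℕ),
      if kids (T ν) = K then ∏ p ∈ K, truncProd z j T n (p :: ν) else 0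

/-- The information carried by the delays at the events in the set `S` of nodes. -/
abbrev delayAlgebra (D : ClusterData d Ω) (S : Set (Node d)) : MeasurableSpace Ω :=
  ⨆ ν ∈ S, MeasurableSpace.comap (D.delay ν) inferInstance

omit [MeasurableSpace Ω] in
theorem measurable_delay_delayAlgebra {S : Set (Node d)} {ν : Node d} (h : ν ∈ S) :
    Measurable[delayAlgebra D S] (D.delay ν) :=
  (Measurable.of_comap_le le_rfl).mono
    (le_iSup₂ (f := fun ν (_ : ν ∈ S) => MeasurableSpace.comap (D.delay ν) inferInstance) ν h)
    le_rfl

omit [MeasurableSpace Ω] in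
theorem delayAlgebra_mono {S S' : Set (Node d)} (h : S ⊆ S') :
    delayAlgebra D S ≤ delayAlgebra D S' :=
  biSup_mono h

theorem Model.IsCluster.delayAlgebra_le (hD : M.IsCluster μ j D) (S : Set (Node d)) :
    delayAlgebra D S ≤ ‹MeasurableSpace Ω› :=
  iSup₂_le fun ν _ => (hD.measurable_delay ν).comap_le

theorem Model.IsCluster.indep_delayAlgebra (hD : M.IsCluster μ j D) {S S' : Set (Node d)}
    (h : Disjoint S S') : Indep (delayAlgebra D S) (delayAlgebra D S') μ := by
  have hi : iIndepFun (fun ν => D.delay ν) μ := hD.indep.comp (fun _ => Prod.snd)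
    (fun _ => measurable_snd)
  exact indep_iSup_of_disjoint (fun ν => (hD.measurable_delay ν).comap_le) hi.iIndep h

omit [MeasurableSpace Ω] in
theorem measurable_truncProd (z : Fin d → ℝ≥0∞) (j : Fin d) (n : ℕ) (ν : Node d) :
    Measurable[delayAlgebra D {ν' | ν <:+ ν'}]
      (fun ω => truncProd z j (fun ν => D.delay ν ω) n ν) := by
  classical
  induction n generalizing ν with
  | zero => exact measurable_const
  | succ n ih =>
    refine Measurable.const_mul (@Measurable.tsum _ _ _
      (delayAlgebra D {ν' | ν <:+ ν'}) _ _ _ _ _ _ _ _ _ _ _ _ fun K => ?_) _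
    refine Measurable.ite ?_ ?_ measurable_const
    · exact measurable_delay_delayAlgebra (S := {ν' | ν <:+ ν'}) (List.suffix_refl ν)
        (measurableSet_kids_eq (K : Set (Fin d × ℕ)))
    · refine Finset.measurable_prod _ fun p _ => (ih (p :: ν)).mono (delayAlgebra_mono ?_) le_rfl
      exact fun ν' h => (List.suffix_cons p ν).trans h

theorem disjoint_suffix_cons {p q : Fin d × ℕ} (h : p ≠ q) (ν : Node d) :
    Disjoint {ν' | (p :: ν) <:+ ν'} {ν' : Node d | (q :: ν) <:+ ν'} := by
  rw [Set.disjoint_left]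
  intro ν' h1 h2
  have := List.suffix_of_suffix_length_le h1 h2 (by simp)
  have := this.eq_of_length (by simp)
  exact h (List.cons.inj this).1

theorem Model.IsCluster.lintegral_prod_truncProd [IsProbabilityMeasure μ]
    (hD : M.IsCluster μ j D) (z : Fin d → ℝ≥0∞) (n : ℕ) (ν : Node d)
    (K : Finset (Fin d × ℕ)) :
    ∫⁻ ω, ∏ p ∈ K, truncProd z j (fun ν => D.delay ν ω) n (p :: ν) ∂μ =
      ∏ p ∈ K, ∫⁻ ω, truncProd z j (fun ν => D.delay ν ω) n (p :: ν) ∂μ := by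
  classical
  induction K using Finset.induction_on with
  | empty => simp
  | insert q K hq ih =>
    simp_rw [Finset.prod_insert hq]
    rw [← ih]
    refine lintegral_mul_eq_lintegral_mul_lintegral_of_independent_measurableSpace
      (hD.delayAlgebra_le _) (hD.delayAlgebra_le _)
      (hD.indep_delayAlgebra (S := {ν' | (q :: ν) <:+ ν'})
        (S' := ⋃ p ∈ K, {ν' | (p :: ν) <:+ ν'}) ?_) (measurable_truncProd z j n _)
      (Finset.measurable_prod _ fun p hp => (measurable_truncProd z j n _).mono
        (delayAlgebra_mono ?_) le_rfl)
    · refine Set.disjoint_iUnion₂_right.2 fun p hp => disjoint_suffix_cons ?_ ν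
      rintro rfl
      exact hq hp
    · exact Set.subset_biUnion_of_mem (u := fun p => {ν' | (p :: ν) <:+ ν'})
        (Finset.mem_coe.2 hp)

/-- Branching property: conditionally on its children, the family trees of the children of an
event are independent, and the truncated generating functions obey the offspring recursion. -/
theorem Model.IsCluster.lintegral_truncProd [IsProbabilityMeasure μ]
    (hD : M.IsCluster μ j D) (z : Fin d → ℝ≥0∞) (n : ℕ) (ν : Node d) :
    ∫⁻ ω, truncProd z j (fun ν => D.delay ν ω) n ν ∂μ = M.iter z n (nodeType j ν) := by
  classical
  induction n generalizing ν with
  | zero => simp [truncProd, Model.iter]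
  | succ n ih =>
    have hm : ∀ K : Finset (Fin d × ℕ), Measurable fun ω =>
        ∏ p ∈ K, truncProd z j (fun ν => D.delay ν ω) n (p :: ν) := fun K =>
      Finset.measurable_prod _ fun p _ =>
        (measurable_truncProd z j n _).mono (hD.delayAlgebra_le _) le_rfl
    have hm' : ∀ K : Finset (Fin d × ℕ), Measurable fun ω =>
        if kids (D.delay ν ω) = K then
          ∏ p ∈ K, truncProd z j (fun ν => D.delay ν ω) n (p :: ν) else 0 := fun K =>
      Measurable.ite (hD.measurableSet_kids ν K) (hm K) measurable_const
    simp only [truncProd, Model.iter]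
    rw [lintegral_const_mul _ (Measurable.tsum hm'),
      lintegral_tsum fun K => (hm' K).aemeasurable, ← hD.tsum_kids ν]
    congr 1
    refine tsum_congr fun K => ?_
    have e : ∀ ω, (if kids (D.delay ν ω) = K then
        ∏ p ∈ K, truncProd z j (fun ν => D.delay ν ω) n (p :: ν) else 0) =
        (if kids (D.delay ν ω) = K then (1 : ℝ≥0∞) else 0) *
          ∏ p ∈ K, truncProd z j (fun ν => D.delay ν ω) n (p :: ν) := by
      intro ω
      split_ifs <;> simp
    have hone : Measurable[delayAlgebra D {ν}] fun ω =>
        if kids (D.delay ν ω) = K then (1 : ℝ≥0∞) else 0 :=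
      Measurable.ite (measurable_delay_delayAlgebra (Set.mem_singleton ν)
        (measurableSet_kids_eq (K : Set (Fin d × ℕ)))) measurable_const measurable_const
    simp_rw [e]
    rw [lintegral_mul_eq_lintegral_mul_lintegral_of_independent_measurableSpace
      (hD.delayAlgebra_le _) (hD.delayAlgebra_le _)
      (hD.indep_delayAlgebra (S := {ν}) (S' := ⋃ p ∈ K, {ν' | (p :: ν) <:+ ν'}) ?_)
      hone (Finset.measurable_prod _ fun p hp => (measurable_truncProd z j n _).mono
        (delayAlgebra_mono ?_) le_rfl),
      hD.lintegral_prod_truncProd]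
    · congr 1
      · rw [← lintegral_indicator_one (hD.measurableSet_kids ν K)]
        rfl
      · exact Finset.prod_congr rfl fun p _ => ih (p :: ν)
    · rw [Set.disjoint_singleton_left]
      simp only [Set.mem_iUnion, not_exists]
      intro p _ h
      have := h.length_le
      simp at this
    · exact Set.subset_biUnion_of_mem (u := fun p => {ν' | (p :: ν) <:+ ν'})
        (Finset.mem_coe.2 hp)

end Cluster

/-! ### The family tree of a cluster -/

/-- The label `ρ`, relative to the event `ν`, belongs to an event, provided that `ν` does. -/
def Alive (T : Node d → Fin d → ℕ → ℝ≥0∞) (ν : Node d) : Node d → Prop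
  | [] => True
  | p :: ρ => Alive T ν ρ ∧ p ∈ kids (T (ρ ++ ν))

/-- The relative labels of the event `ν` and its descendants. -/
def progeny (T : Node d → Fin d → ℕ → ℝ≥0∞) (ν : Node d) : Set (Node d) := {ρ | Alive T ν ρ}

theorem alive_append_singleton (T : Node d → Fin d → ℕ → ℝ≥0∞) (ν ρ : Node d) (p : Fin d × ℕ) :
    Alive T ν (ρ ++ [p]) ↔ p ∈ kids (T ν) ∧ Alive T (p :: ν) ρ := by
  induction ρ with
  | nil => simp [Alive]
  | cons q ρ ih =>
    rw [List.cons_append, Alive, ih, Alive, List.append_assoc, List.singleton_append, and_assoc]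

theorem nil_mem_progeny (T : Node d → Fin d → ℕ → ℝ≥0∞) (ν : Node d) : [] ∈ progeny T ν :=
  trivial

/-- A family tree consists of its root and the family trees of the children of the root. -/
theorem progeny_eq (T : Node d → Fin d → ℕ → ℝ≥0∞) (ν : Node d) :
    progeny T ν = insert [] (⋃ p ∈ kids (T ν), (fun ρ => ρ ++ [p]) '' progeny T (p :: ν)) := by
  ext ρ
  rcases List.eq_nil_or_concat' ρ with rfl | ⟨ρ, p, rfl⟩
  · simp [nil_mem_progeny]
  · simp only [progeny, Set.mem_ofPred_eq, Set.mem_insert_iff, Set.mem_iUnion, Set.mem_image,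
      alive_append_singleton]
    constructor
    · rintro ⟨h1, h2⟩
      exact Or.inr ⟨p, h1, ρ, h2, rfl⟩
    · rintro (h | ⟨q, h1, ρ', h2, h⟩)
      · simp at h
      · obtain ⟨rfl, h3⟩ := List.append_inj' h rfl
        obtain rfl : q = p := by simpa using h3
        exact ⟨h1, h2⟩

theorem truncProd_succ (z : Fin d → ℝ≥0∞) (j : Fin d) (T : Node d → Fin d → ℕ → ℝ≥0∞) (n : ℕ)
    (ν : Node d) {K : Finset (Fin d × ℕ)} (hK : kids (T ν) = K) :
    truncProd z j T (n + 1) ν =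
      z (nodeType j ν) * ∏ p ∈ K, truncProd z j T n (p :: ν) := by
  classical
  rw [truncProd, tsum_eq_single K]
  · simp [hK]
  · intro K' hK'
    rw [if_neg]
    intro h
    exact hK' (Finset.coe_injective (h.symm.trans hK))

theorem nodeType_append_append (j : Fin d) (ρ ν : Node d) (p : Fin d × ℕ) :
    nodeType j ((ρ ++ [p]) ++ ν) = nodeType j (ρ ++ p :: ν) := by
  simp

theorem truncProd_eq_prod (z : Fin d → ℝ≥0∞) (j : Fin d) (T : Node d → Fin d → ℕ → ℝ≥0∞)
    (n : ℕ) (ν : Node d) (S : Finset (Node d)) (hS : progeny T ν = S)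
    (hn : ∀ ρ ∈ S, ρ.length < n) :
    truncProd z j T n ν = ∏ ρ ∈ S, z (nodeType j (ρ ++ ν)) := by
  classical
  induction n generalizing ν S with
  | zero =>
    have : ([] : Node d) ∈ S := by
      rw [← Finset.mem_coe, ← hS]
      exact nil_mem_progeny T ν
    exact absurd (hn _ this) (by simp)
  | succ n ih =>
    have hkid : (kids (T ν)).Finite := by
      refine Set.Finite.of_finite_image (f := fun p : Fin d × ℕ => ([p] : Node d))
        (S.finite_toSet.subset ?_) (fun p _ q _ h => by simpa using h)
      rintro _ ⟨p, hp, rfl⟩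
      rw [← hS]
      exact (alive_append_singleton T ν [] p).2 ⟨hp, trivial⟩
    have hinj : ∀ p : Fin d × ℕ, Function.Injective fun ρ : Node d => ρ ++ [p] :=
      fun p => List.append_left_injective [p]
    set K := hkid.toFinset with hKdef
    have hK : kids (T ν) = K := by simp [hKdef]
    let R : Fin d × ℕ → Finset (Node d) := fun p =>
      S.preimage (fun ρ => ρ ++ [p]) (hinj p).injOn
    have hR : ∀ p ∈ K, progeny T (p :: ν) = R p := by
      intro p hp
      have hp' : p ∈ kids (T ν) := by rw [hK]; exact hp
      ext ρ
      simp only [R, Finset.coe_preimage, Set.mem_preimage, ← hS]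
      simp [progeny, alive_append_singleton, hp']
    have hSK : S = insert [] (K.biUnion fun p => (R p).image fun ρ => ρ ++ [p]) := by
      apply Finset.coe_injective
      rw [← hS, progeny_eq]
      push_cast
      congr 1
      rw [hK]
      exact Set.iUnion₂_congr fun p hp => by rw [hR p hp]
    have hdis : (K : Set (Fin d × ℕ)).PairwiseDisjoint
        fun p => (R p).image fun ρ => ρ ++ [p] := by
      intro p _ q _ hpq
      refine Finset.disjoint_left.2 ?_
      intro ρ hp hq
      obtain ⟨a, -, rfl⟩ := Finset.mem_image.1 hp
      obtain ⟨b, -, h⟩ := Finset.mem_image.1 hq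
      have := (List.append_inj' h rfl).2
      exact hpq (by simpa using this.symm)
    rw [truncProd_succ z j T n ν hK, hSK, Finset.prod_insert (by simp), Finset.prod_biUnion hdis]
    congr 1
    refine Finset.prod_congr rfl fun p hp => ?_
    rw [Finset.prod_image (fun a _ b _ h => hinj p h), ih (p :: ν) (R p) (hR p hp)]
    · exact Finset.prod_congr rfl fun ρ _ => by rw [nodeType_append_append]
    · intro ρ hρ
      have := hn (ρ ++ [p]) (by simpa [R] using hρ)
      simpa using this

theorem progeny_finite_of_truncProd_ne_zero (z : Fin d → ℝ≥0∞) (j : Fin d)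
    (T : Node d → Fin d → ℕ → ℝ≥0∞) (n : ℕ) (ν : Node d) (h : truncProd z j T n ν ≠ 0) :
    (progeny T ν).Finite := by
  classical
  induction n generalizing ν with
  | zero => exact absurd rfl h
  | succ n ih =>
    have h2 : ∃ K : Finset (Fin d × ℕ), kids (T ν) = K := by
      by_contra! hne
      exact h (by simp [truncProd, hne])
    obtain ⟨K, hK⟩ := h2
    rw [truncProd_succ z j T n ν hK] at h
    rw [progeny_eq, hK]
    refine Set.Finite.insert _ (Set.Finite.biUnion K.finite_toSet fun p hp => ?_)
    exact (ih (p :: ν) (Finset.prod_ne_zero_iff.1 (right_ne_zero_of_mul h) p hp)).image _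

theorem truncProd_mono (z : Fin d → ℝ≥0∞) (j : Fin d) (T : Node d → Fin d → ℕ → ℝ≥0∞)
    (ν : Node d) : Monotone fun n => truncProd z j T n ν := by
  classical
  refine monotone_nat_of_le_succ fun n => ?_
  induction n generalizing ν with
  | zero => exact zero_le
  | succ n ih =>
    refine mul_le_mul_right (ENNReal.tsum_le_tsum fun K => ?_) _
    split_ifs
    · exact Finset.prod_le_prod' fun p _ => ih (p :: ν)
    · exact le_rfl

open Classical in
theorem iSup_truncProd (z : Fin d → ℝ≥0∞) (j : Fin d) (T : Node d → Fin d → ℕ → ℝ≥0∞)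
    (ν : Node d) : ⨆ n, truncProd z j T n ν =
      if h : (progeny T ν).Finite then ∏ ρ ∈ h.toFinset, z (nodeType j (ρ ++ ν)) else 0 := by
  split_ifs with h
  · set N := h.toFinset.sup List.length + 1
    have hN : ∀ n, N ≤ n →
        truncProd z j T n ν = ∏ ρ ∈ h.toFinset, z (nodeType j (ρ ++ ν)) := by
      intro n hn
      refine truncProd_eq_prod z j T n ν _ (by simp) fun ρ hρ => ?_
      exact lt_of_lt_of_le (Nat.lt_succ_of_le (Finset.le_sup (f := List.length) hρ)) hn
    refine le_antisymm (iSup_le fun n => ?_) ?_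
    · rw [← hN (max n N) (le_max_right _ _)]
      exact truncProd_mono z j T ν (le_max_left _ _)
    · rw [← hN N le_rfl]
      exact le_iSup (fun n => truncProd z j T n ν) N
  · refine ENNReal.iSup_eq_zero.2 fun n => ?_
    by_contra hne
    exact h (progeny_finite_of_truncProd_ne_zero z j T n ν hne)

/-! ### Cluster sizes -/

section Size

variable {Ω : Type*}

theorem ClusterData.birth_ne_top_iff (D : ClusterData d Ω) (ω : Ω) (ν : Node d) :
    D.birth ν ω ≠ ⊤ ↔ ν ∈ progeny (fun ν => D.delay ν ω) [] := by
  induction ν with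
  | nil => simp [birth, nil_mem_progeny]
  | cons p ν ih =>
    obtain ⟨m, n⟩ := p
    have : (m, n) :: ν ∈ progeny (fun ν => D.delay ν ω) [] ↔
      ν ∈ progeny (fun ν => D.delay ν ω) [] ∧ D.delay ν ω m n ≠ ⊤ := by
      simp [progeny, Alive, kids]
    rw [this, birth, ENNReal.add_ne_top, ih]

theorem ClusterData.size_eq (D : ClusterData d Ω) (j i : Fin d) (ω : Ω) :
    D.size j i ω =
      {ν | ν ∈ progeny (fun ν => D.delay ν ω) [] ∧ nodeType j ν = i}.encard := by
  simp_rw [← D.birth_ne_top_iff]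
  unfold ClusterData.size ClusterData.count
  refine le_antisymm (iSup_le fun u => Set.encard_le_encard ?_) ?_
  · rintro ν ⟨h1, h2⟩
    exact ⟨ne_top_of_le_ne_top ENNReal.coe_ne_top h2, h1⟩
  · refine ENat.forall_natCast_le_iff_le.1 fun n hn => ?_
    obtain ⟨S, hS, hcard⟩ := Set.exists_subset_encard_eq hn
    have hfin : S.Finite := Set.finite_of_encard_eq_coe hcard
    have hbd : ∃ u : ℝ≥0, ∀ ν ∈ S, D.birth ν ω ≤ u := by
      refine ⟨∑ ν ∈ hfin.toFinset, (D.birth ν ω).toNNReal, fun ν hν => ?_⟩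
      rw [← ENNReal.coe_toNNReal (hS hν).1]
      exact ENNReal.coe_le_coe.2 (Finset.single_le_sum
        (f := fun ν => (D.birth ν ω).toNNReal) (fun _ _ => zero_le) (by simpa using hν))
    obtain ⟨u, hu⟩ := hbd
    rw [← hcard]
    refine le_trans ?_
      (le_iSup (fun u : ℝ≥0 => {ν : Node d | nodeType j ν = i ∧ D.birth ν ω ≤ u}.encard) u)
    exact Set.encard_le_encard fun ν hν => ⟨(hS hν).2, hu ν hν⟩

theorem ClusterData.size_lt_top (D : ClusterData d Ω) (j i : Fin d) {ω : Ω}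
    (h : (progeny (fun ν => D.delay ν ω) []).Finite) : D.size j i ω < ⊤ := by
  rw [D.size_eq, Set.encard_lt_top_iff]
  exact h.subset fun ν hν => hν.1

theorem ClusterData.prod_pow_size (D : ClusterData d Ω) (j : Fin d) (z : Fin d → ℝ≥0∞) {ω : Ω}
    (h : (progeny (fun ν => D.delay ν ω) []).Finite) :
    ∏ l, z l ^ (D.size j l ω).toNat =
      ⨆ n, truncProd z j (fun ν => D.delay ν ω) n [] := by
  classical
  rw [iSup_truncProd, dif_pos h, ← Finset.prod_fiberwise h.toFinset (fun ν => nodeType j ν)]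
  refine Finset.prod_congr rfl fun l _ => ?_
  have e : {ν | ν ∈ progeny (fun ν => D.delay ν ω) [] ∧ nodeType j ν = l} =
      ((h.toFinset.filter fun ν => nodeType j ν = l : Finset _) : Set (Node d)) := by
    ext; simp
  rw [D.size_eq, e, Set.encard_coe_eq_coe_finsetCard, ENat.toNat_natCast, ← Finset.prod_const]
  refine Finset.prod_congr rfl fun ν hν => ?_
  rw [List.append_nil, (Finset.mem_filter.1 hν).2]

end Size

section Expectation

variable {M : Model d} {Ω : Type*} [MeasurableSpace Ω] {μ : Measure Ω} {j : Fin d}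
  {D : ClusterData d Ω} [IsProbabilityMeasure μ]

theorem Model.IsCluster.lintegral_iSup_truncProd (hD : M.IsCluster μ j D) (z : Fin d → ℝ≥0∞) :
    ∫⁻ ω, ⨆ n, truncProd z j (fun ν => D.delay ν ω) n [] ∂μ = ⨆ n, M.iter z n j := by
  rw [lintegral_iSup (fun n => (measurable_truncProd z j n _).mono (hD.delayAlgebra_le _) le_rfl)
    (fun n m h ω => truncProd_mono z j _ _ h)]
  exact iSup_congr fun n => hD.lintegral_truncProd z n []

/-- The total family tree is almost surely finite once the iterates at `z = 1`, which are the
probabilities of having at most a given number of generations, tend to `1`. -/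
theorem Model.IsCluster.ae_finite_progeny (hD : M.IsCluster μ j D)
    (h : ⨆ n, M.iter 1 n j = 1) : ∀ᵐ ω ∂μ, (progeny (fun ν => D.delay ν ω) []).Finite := by
  classical
  have h1 := hD.lintegral_iSup_truncProd 1
  have hm : Measurable fun ω => ⨆ n, truncProd 1 j (fun ν => D.delay ν ω) n [] :=
    Measurable.iSup fun n => (measurable_truncProd 1 j n _).mono (hD.delayAlgebra_le _) le_rfl
  have hle : ∀ ω, ⨆ n, truncProd 1 j (fun ν => D.delay ν ω) n [] ≤ 1 := by
    intro ω
    rw [iSup_truncProd]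
    split_ifs <;> simp
  have hae : (fun ω => ⨆ n, truncProd 1 j (fun ν => D.delay ν ω) n []) =ᵐ[μ] fun _ => 1 := by
    refine ae_eq_of_ae_le_of_lintegral_le (Filter.Eventually.of_forall hle) ?_ (by fun_prop) ?_
    · rw [h1, h]; simp
    · rw [h1, h]; simp
  filter_upwards [hae] with ω hω
  by_contra hf
  rw [iSup_truncProd, dif_neg hf] at hω
  exact zero_ne_one hω

theorem Model.IsCluster.lintegral_prod_pow_size (hD : M.IsCluster μ j D)
    (h : ⨆ n, M.iter 1 n j = 1) (z : Fin d → ℝ≥0∞) :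
    ∫⁻ ω, ∏ l, z l ^ (D.size j l ω).toNat ∂μ = ⨆ n, M.iter z n j := by
  rw [← hD.lintegral_iSup_truncProd]
  refine lintegral_congr_ae ?_
  filter_upwards [hD.ae_finite_progeny h] with ω hω
  exact D.prod_pow_size j z hω

end Expectation

namespace Model

variable (M : Model d)

/-! ### Convexity of the weights -/

/-- The linear form `y ↦ ∑_m b_m c_{mj} y_m`, the exponent of the weight up to a shift. -/
noncomputable def form (j : Fin d) (y : Fin d → ℝ) (b : Fin d → ℝ≥0) : ℝ :=
  ∑ m, (b m : ℝ) * M.c m j * y m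

variable {M}

theorem coeff_nonneg (b : Fin d → ℝ≥0) (m j : Fin d) : 0 ≤ (b m : ℝ) * M.c m j :=
  mul_nonneg (b m).2 (M.c_nonneg m j)

theorem form_nonneg (j : Fin d) {y : Fin d → ℝ} (hy : 0 ≤ y) (b : Fin d → ℝ≥0) :
    0 ≤ M.form j y b :=
  Finset.sum_nonneg fun m _ => mul_nonneg (coeff_nonneg b m j) (hy m)

theorem form_mono (j : Fin d) {y y' : Fin d → ℝ} (hy : y ≤ y') (b : Fin d → ℝ≥0) :
    M.form j y b ≤ M.form j y' b :=
  Finset.sum_le_sum fun m _ => mul_le_mul_of_nonneg_left (hy m) (coeff_nonneg b m j)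

theorem form_smul (j : Fin d) (t : ℝ) (y : Fin d → ℝ) (b : Fin d → ℝ≥0) :
    M.form j (t • y) b = t * M.form j y b := by
  simp only [form, Pi.smul_apply, smul_eq_mul, Finset.mul_sum]
  exact Finset.sum_congr rfl fun m _ => by ring

theorem form_sub (j : Fin d) (y y' : Fin d → ℝ) (b : Fin d → ℝ≥0) :
    M.form j (y - y') b = M.form j y b - M.form j y' b := by
  simp only [form, Pi.sub_apply, ← Finset.sum_sub_distrib]
  exact Finset.sum_congr rfl fun m _ => by ring

theorem weight_eq_exp_form (j : Fin d) (x : Fin d → ℝ) (b : Fin d → ℝ≥0) :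
    M.weight j x b = Real.exp (M.form j (x - 1) b) := rfl

theorem weight_pos (j : Fin d) (x : Fin d → ℝ) (b : Fin d → ℝ≥0) : 0 < M.weight j x b :=
  Real.exp_pos _

theorem weight_mul_exp (j : Fin d) (x x' : Fin d → ℝ) (b : Fin d → ℝ≥0) :
    M.weight j x b * Real.exp (M.form j (x' - x) b) = M.weight j x' b := by
  rw [weight_eq_exp_form, weight_eq_exp_form, ← Real.exp_add, form_sub, form_sub, form_sub]
  congr 1
  ring

theorem weight_mono (j : Fin d) {x x' : Fin d → ℝ} (h : x ≤ x') (b : Fin d → ℝ≥0) :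
    M.weight j x b ≤ M.weight j x' b :=
  Real.exp_le_exp.2 (form_mono j (sub_le_sub_right h 1) b)

/-- The tangent to the weight at `x` lies below it. -/
theorem tangent_le_weight (j : Fin d) (x x' : Fin d → ℝ) (b : Fin d → ℝ≥0) :
    M.weight j x b + M.form j (x' - x) b * M.weight j x b ≤ M.weight j x' b := by
  rw [← weight_mul_exp j x x']
  nlinarith [Real.add_one_le_exp (M.form j (x' - x) b), weight_pos (M := M) j x b]

theorem form_eq_zero_of_tangent_eq (j : Fin d) {x x' : Fin d → ℝ} {b : Fin d → ℝ≥0}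
    (h : M.weight j x b + M.form j (x' - x) b * M.weight j x b = M.weight j x' b) :
    M.form j (x' - x) b = 0 := by
  by_contra hne
  rw [← weight_mul_exp j x x'] at h
  nlinarith [Real.add_one_lt_exp hne, weight_pos (M := M) j x b]

theorem measurable_form (j : Fin d) (y : Fin d → ℝ) : Measurable (M.form j y) := by
  unfold form
  fun_prop

theorem measurable_weight (j : Fin d) (x : Fin d → ℝ) : Measurable (M.weight j x) := by
  unfold weight
  fun_prop

theorem integrable_weight_of_le (j : Fin d) {x x' : Fin d → ℝ} (h : x ≤ x')
    (hi : Integrable (M.weight j x') (M.markLaw j)) :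
    Integrable (M.weight j x) (M.markLaw j) :=
  hi.mono' (measurable_weight j x).aestronglyMeasurable (Filter.Eventually.of_forall fun b => by
    rw [Real.norm_of_nonneg (weight_pos j x b).le]
    exact weight_mono j h b)

theorem integral_weight_pos (j : Fin d) {x : Fin d → ℝ}
    (hi : Integrable (M.weight j x) (M.markLaw j)) : 0 < ∫ b, M.weight j x b ∂(M.markLaw j) := by
  have := M.markLaw_prob j
  exact integral_exp_pos hi

/-- The derivative of the weight in a non-negative direction is integrable as soon as the
weight is integrable a little further in this direction. -/
theorem integrable_form_mul_weight (j : Fin d) {x x' : Fin d → ℝ} (h : x ≤ x')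
    (hi : Integrable (M.weight j x') (M.markLaw j)) :
    Integrable (fun b => M.form j (x' - x) b * M.weight j x b) (M.markLaw j) := by
  refine hi.mono' ((measurable_form j _).mul (measurable_weight j x)).aestronglyMeasurable
    (Filter.Eventually.of_forall fun b => ?_)
  rw [Real.norm_of_nonneg (mul_nonneg (form_nonneg j (sub_nonneg.2 h) b) (weight_pos j x b).le)]
  linarith [tangent_le_weight (M := M) j x x' b, weight_pos (M := M) j x b]

/-! ### The minimal solution of the fixed-point system -/

variable (M)

/-- The minimal solution in `[0, ∞]^d` of `f_j = z_j E ∏_m f_m ^ N_m`, as the limit of the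
iterates started at `0`. -/
noncomputable def minSol (z : Fin d → ℝ) (j : Fin d) : ℝ≥0∞ :=
  ⨆ n, M.iter (fun l => ENNReal.ofReal (z l)) n j

variable {M}

theorem lintegral_weight (j : Fin d) {x : Fin d → ℝ}
    (hi : Integrable (M.weight j x) (M.markLaw j)) :
    ∫⁻ b, ENNReal.ofReal (M.weight j x b) ∂(M.markLaw j) =
      ENNReal.ofReal (∫ b, M.weight j x b ∂(M.markLaw j)) :=
  (ofReal_integral_eq_lintegral_ofReal hi
    (Filter.Eventually.of_forall fun b => (weight_pos j x b).le)).symm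

theorem offspring_ofReal (j : Fin d) {x : Fin d → ℝ} (hx : 0 ≤ x) :
    M.offspring j (fun m => ENNReal.ofReal (x m)) =
      ∫⁻ b, ENNReal.ofReal (M.weight j x b) ∂(M.markLaw j) := by
  have h := M.offspring_coe j (fun m => (x m).toNNReal)
  have e : (fun m => (((x m).toNNReal : ℝ≥0) : ℝ)) = x :=
    funext fun m => Real.coe_toNNReal _ (hx m)
  rw [e] at h
  exact h

/-- The minimal solution lies below every supersolution. -/
theorem minSol_le {z x : Fin d → ℝ} (hx : 0 ≤ x)
    (hi : ∀ j, Integrable (M.weight j x) (M.markLaw j))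
    (h : ∀ j, z j * ∫ b, M.weight j x b ∂(M.markLaw j) ≤ x j) (j : Fin d) :
    M.minSol z j ≤ ENNReal.ofReal (x j) := by
  refine iSup_le fun n => ?_
  suffices hn : ∀ n, M.iter (fun l => ENNReal.ofReal (z l)) n ≤
      fun m => ENNReal.ofReal (x m) from hn n j
  intro n
  induction n with
  | zero => intro j; exact zero_le
  | succ n ih =>
    intro j
    calc _ ≤ ENNReal.ofReal (z j) * M.offspring j (fun m => ENNReal.ofReal (x m)) :=
          mul_le_mul_right (M.offspring_mono j ih) _
      _ = ENNReal.ofReal (z j * ∫ b, M.weight j x b ∂(M.markLaw j)) := by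
          rw [offspring_ofReal j hx, lintegral_weight j (hi j),
            ENNReal.ofReal_mul' (integral_weight_pos j (hi j)).le]
      _ ≤ _ := ENNReal.ofReal_le_ofReal (h j)

/-- Monotone convergence along the iterates: where it is finite, the minimal solution does satisfy the
fixed-point system. -/
theorem minSol_eq {z : Fin d → ℝ} (hfin : ∀ j, M.minSol z j < ⊤) (j : Fin d) :
    M.minSol z j = ENNReal.ofReal (z j) *
      ∫⁻ b, ENNReal.ofReal (M.weight j (fun m => (M.minSol z m).toReal) b) ∂(M.markLaw j) := by
  set a : ℕ → Fin d → ℝ≥0∞ := M.iter (fun l => ENNReal.ofReal (z l)) with ha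
  have hmono : Monotone a := M.iter_mono _
  have hle : ∀ n m, a n m ≤ M.minSol z m := fun n m => le_iSup (fun n => a n m) n
  have hlt : ∀ n m, a n m ≠ ⊤ := fun n m => ((hle n m).trans_lt (hfin m)).ne
  have hoff : ∀ n, M.offspring j (a n) =
      ∫⁻ b, ENNReal.ofReal (M.weight j (fun m => (a n m).toReal) b) ∂(M.markLaw j) := by
    intro n
    rw [← offspring_ofReal j (fun m => ENNReal.toReal_nonneg)]
    congr 1
    funext m
    exact (ENNReal.ofReal_toReal (hlt n m)).symm
  have hmr : ∀ b, Monotone fun n => ENNReal.ofReal (M.weight j (fun m => (a n m).toReal) b) :=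
    fun b n n' h => ENNReal.ofReal_le_ofReal (weight_mono j
      (fun m => ENNReal.toReal_mono (hlt n' m) (hmono h m)) b)
  have hlim : ∀ m, Filter.Tendsto (fun n => (a n m).toReal) Filter.atTop
      (nhds (M.minSol z m).toReal) := fun m =>
    (ENNReal.tendsto_toReal (hfin m).ne).comp
      (tendsto_atTop_iSup fun n n' h => hmono h m)
  have hw : ∀ b, ⨆ n, ENNReal.ofReal (M.weight j (fun m => (a n m).toReal) b) =
      ENNReal.ofReal (M.weight j (fun m => (M.minSol z m).toReal) b) := by
    intro b
    refine iSup_eq_of_tendsto (hmr b) (ENNReal.tendsto_ofReal ?_)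
    unfold weight
    refine (Real.continuous_exp.tendsto _).comp (tendsto_finsetSum _ fun m _ => ?_)
    exact ((hlim m).sub_const 1).const_mul _
  have hsucc : M.minSol z j = ⨆ n, a (n + 1) j :=
    (Monotone.iSup_nat_add (f := fun n => a n j) (fun n n' h => hmono h j) 1).symm
  rw [hsucc]
  have : ∀ n, a (n + 1) j = ENNReal.ofReal (z j) * M.offspring j (a n) := fun n => rfl
  simp_rw [this, ← ENNReal.mul_iSup, hoff]
  congr 1
  rw [← lintegral_iSup (fun n => (measurable_weight j _).ennreal_ofReal)
    (fun n n' h b => hmr b h)]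
  exact lintegral_congr hw

theorem integrable_weight_minSol {z : Fin d → ℝ} (hfin : ∀ j, M.minSol z j < ⊤) {j : Fin d}
    (hz : 0 < z j) :
    Integrable (M.weight j fun m => (M.minSol z m).toReal) (M.markLaw j) := by
  refine ⟨(measurable_weight j _).aestronglyMeasurable, ?_⟩
  rw [hasFiniteIntegral_iff_ofReal (Filter.Eventually.of_forall fun b => (weight_pos j _ b).le)]
  have h := hfin j
  rw [minSol_eq hfin] at h
  exact ENNReal.lt_top_of_mul_ne_top_right h.ne (by simpa using hz)

theorem toReal_minSol_eq {z : Fin d → ℝ} (hz : 0 ≤ z) (hfin : ∀ j, M.minSol z j < ⊤) {j : Fin d}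
    (hi : Integrable (M.weight j fun m => (M.minSol z m).toReal) (M.markLaw j)) :
    (M.minSol z j).toReal =
      z j * ∫ b, M.weight j (fun m => (M.minSol z m).toReal) b ∂(M.markLaw j) := by
  conv_lhs => rw [minSol_eq hfin, lintegral_weight j hi]
  rw [ENNReal.toReal_mul, ENNReal.toReal_ofReal (hz j),
    ENNReal.toReal_ofReal (integral_weight_pos j hi).le]

/-! ### Stability and almost sure finiteness -/

theorem integrable_mark (hmgf : ∃ ϑ : Fin d → ℝ, (∀ m, 0 < ϑ m) ∧ ∀ j, M.MgfFinite j ϑ)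
    (k j : Fin d) : Integrable (fun b : Fin d → ℝ≥0 => (b k : ℝ)) (M.markLaw j) := by
  obtain ⟨ϑ, hpos, hi⟩ := hmgf
  refine ((hi j).const_mul (ϑ k)⁻¹).mono'
    (measurable_coe_nnreal_real.comp (measurable_pi_apply k)).aestronglyMeasurable (Filter.Eventually.of_forall fun b => ?_)
  have h1 : (b k : ℝ) * ϑ k ≤ ∑ m, (b m : ℝ) * ϑ m :=
    Finset.single_le_sum (f := fun m => (b m : ℝ) * ϑ m)
      (fun m _ => mul_nonneg (b m).2 (hpos m).le) (Finset.mem_univ k)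
  have h2 := Real.add_one_le_exp (∑ m, (b m : ℝ) * ϑ m)
  rw [Real.norm_of_nonneg (NNReal.coe_nonneg (b k)), inv_mul_eq_div, le_div_iff₀ (hpos k)]
  linarith

theorem H_nonneg (k j : Fin d) : 0 ≤ M.H k j :=
  mul_nonneg (integral_nonneg fun b => (b k).2) (M.c_nonneg k j)

attribute [local instance] Matrix.linftyOpNormedRing Matrix.linftyOpNormedAlgebra in
theorem tendsto_H_pow (hstable : M.Stable) (i j : Fin d) :
    Filter.Tendsto (fun n : ℕ => (M.H ^ n) i j) Filter.atTop (nhds 0) := by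
  set A : Matrix (Fin d) (Fin d) ℂ := M.H.map (fun a : ℝ => (a : ℂ)) with hA
  obtain ⟨ρ, h1, h2⟩ := ENNReal.lt_iff_exists_nnreal_btwn.1 hstable
  have hev := (spectrum.pow_nnnorm_pow_one_div_tendsto_nhds_spectralRadius A).eventually_lt_const h1
  have hA0 : Filter.Tendsto (fun n : ℕ => ‖A ^ n‖) Filter.atTop (nhds 0) := by
    refine squeeze_zero' (Filter.Eventually.of_forall fun n => norm_nonneg _) ?_
      (tendsto_pow_atTop_nhds_zero_of_lt_one ρ.2 (by exact_mod_cast h2))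
    filter_upwards [hev, Filter.eventually_gt_atTop 0] with n hn hn0
    have hn0' : (0 : ℝ) < n := by exact_mod_cast hn0
    have h3 := ENNReal.rpow_le_rpow hn.le hn0'.le
    rw [← ENNReal.rpow_mul, one_div_mul_cancel hn0'.ne', ENNReal.rpow_one,
      ENNReal.rpow_natCast] at h3
    have h4 : ‖A ^ n‖₊ ≤ ρ ^ n := by exact_mod_cast h3
    exact_mod_cast h4
  have hent : ∀ B : Matrix (Fin d) (Fin d) ℂ, ‖B i j‖ ≤ ‖B‖ := by
    intro B
    rw [Matrix.linfty_opNorm_def]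
    have h5 : ∑ k, ‖B i k‖₊ ≤ Finset.univ.sup fun i => ∑ k, ‖B i k‖₊ :=
      Finset.le_sup (f := fun i => ∑ k, ‖B i k‖₊) (Finset.mem_univ i)
    have h6 : ‖B i j‖₊ ≤ ∑ k, ‖B i k‖₊ :=
      Finset.single_le_sum (f := fun k => ‖B i k‖₊) (fun _ _ => zero_le) (Finset.mem_univ j)
    exact_mod_cast h6.trans h5
  have hpow : ∀ n : ℕ, A ^ n = (M.H ^ n).map (fun a : ℝ => (a : ℂ)) := fun n =>
    (Matrix.map_pow M.H Complex.ofRealHom n).symm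
  refine squeeze_zero_norm (fun n => ?_) hA0
  have := hent (A ^ n)
  rwa [hpow, Matrix.map_apply, Complex.norm_real, ← hpow] at this

theorem eq_zero_of_le_vecMul_H (hstable : M.Stable) {y : Fin d → ℝ} (hy : 0 ≤ y)
    (h : ∀ j, y j ≤ ∑ k, y k * M.H k j) : y = 0 := by
  have hn : ∀ (n : ℕ) j, y j ≤ ∑ k, y k * (M.H ^ n) k j := by
    intro n
    induction n with
    | zero => intro j; simp [Matrix.one_apply]
    | succ n ih =>
      intro j
      calc y j ≤ ∑ k, y k * M.H k j := h j
        _ ≤ ∑ k, (∑ l, y l * (M.H ^ n) l k) * M.H k j :=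
            Finset.sum_le_sum fun k _ => mul_le_mul_of_nonneg_right (ih k) (H_nonneg k j)
        _ = ∑ l, y l * (M.H ^ (n + 1)) l j := by
            simp_rw [pow_succ, Matrix.mul_apply, Finset.mul_sum, Finset.sum_mul]
            rw [Finset.sum_comm]
            simp_rw [mul_assoc]
  refine le_antisymm (fun j => ?_) hy
  refine ge_of_tendsto' (x := Filter.atTop) (f := fun n : ℕ => ∑ k, y k * (M.H ^ n) k j) ?_
    fun n => hn n j
  simpa using tendsto_finsetSum Finset.univ
    fun k _ => (tendsto_H_pow hstable k j).const_mul (y k)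

/-- The extinction probabilities are equal to one: their complements `y` satisfy `y ≤ y H`. -/
theorem minSol_one (hstable : M.Stable)
    (hmgf : ∃ ϑ : Fin d → ℝ, (∀ m, 0 < ϑ m) ∧ ∀ j, M.MgfFinite j ϑ) (j : Fin d) :
    M.minSol 1 j = 1 := by
  have hw1 : ∀ j, M.weight j 1 = fun _ => 1 := fun j => by
    funext b; simp [weight]
  have hle : ∀ j, M.minSol 1 j ≤ 1 := by
    intro j
    have := minSol_le (M := M) (z := 1) (x := 1) (fun _ => zero_le_one)
      (fun j => by
        have := M.markLaw_prob j
        rw [hw1]; exact integrable_const 1)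
      (fun j => by
        have := M.markLaw_prob j
        rw [hw1]; simp) j
    simpa using this
  have hfin : ∀ j, M.minSol 1 j < ⊤ := fun j => (hle j).trans_lt ENNReal.one_lt_top
  set q : Fin d → ℝ := fun m => (M.minSol 1 m).toReal with hq
  have hq1 : q ≤ 1 := fun m => by
    simpa using ENNReal.toReal_mono ENNReal.one_ne_top (hle m)
  have hi : ∀ j, Integrable (M.weight j q) (M.markLaw j) := fun j =>
    integrable_weight_minSol hfin (by simp)
  have hy : (1 : Fin d → ℝ) - q = 0 := by
    refine eq_zero_of_le_vecMul_H hstable (sub_nonneg.2 hq1) fun j => ?_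
    have := M.markLaw_prob j
    have h1 : q j = ∫ b, M.weight j q b ∂(M.markLaw j) := by
      simpa using toReal_minSol_eq (z := 1) (fun _ => zero_le_one) hfin (hi j)
    have hint : ∀ m, Integrable (fun b : Fin d → ℝ≥0 => (b m : ℝ) * M.c m j * (1 - q) m)
        (M.markLaw j) := fun m => ((integrable_mark hmgf m j).mul_const _).mul_const _
    have hint' : Integrable (M.form j (1 - q)) (M.markLaw j) :=
      integrable_finsetSum _ fun m _ => hint m
    have h2 : ∫ b, (1 - M.form j (1 - q) b) ∂(M.markLaw j) ≤
        ∫ b, M.weight j q b ∂(M.markLaw j) := by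
      refine integral_mono ((integrable_const 1).sub hint')
        (hi j) fun b => ?_
      have := tangent_le_weight (M := M) j 1 q b
      rw [hw1] at this
      have e : M.form j (1 - q) b = - M.form j (q - 1) b := by rw [form_sub, form_sub]; ring
      simp only [mul_one] at this
      simp only [e]
      linarith
    have h3 : ∫ b, M.form j (1 - q) b ∂(M.markLaw j) = ∑ k, (1 - q) k * M.H k j := by
      unfold form
      rw [integral_finsetSum _ fun m _ => hint m]
      refine Finset.sum_congr rfl fun m _ => ?_
      rw [integral_mul_const, integral_mul_const, H]
      ring
    rw [integral_sub (integrable_const 1) hint', h3,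
      ← h1] at h2
    simp only [integral_const, probReal_univ, smul_eq_mul, mul_one] at h2
    simp only [Pi.sub_apply, Pi.one_apply] at h2 ⊢
    linarith
  have : q j = 1 := by
    have := congrFun hy j
    simp only [Pi.sub_apply, Pi.one_apply, Pi.zero_apply] at this
    linarith
  rw [← ENNReal.ofReal_toReal (hfin j).ne]
  change ENNReal.ofReal (q j) = 1
  simp [this]

theorem iSup_iter_one (hstable : M.Stable)
    (hmgf : ∃ ϑ : Fin d → ℝ, (∀ m, 0 < ϑ m) ∧ ∀ j, M.MgfFinite j ϑ) (j : Fin d) :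
    ⨆ n, M.iter 1 n j = 1 := by
  have h := minSol_one hstable hmgf j
  unfold minSol at h
  have e : (fun l => ENNReal.ofReal ((1 : Fin d → ℝ) l)) = 1 := by funext l; simp
  rwa [e] at h

end Model

namespace Model

variable {M : Model d}

/-! ### The points `ẑ` as critical points -/

theorem form_mul_weight (j : Fin d) (x y : Fin d → ℝ) (b : Fin d → ℝ≥0) :
    M.form j y b * M.weight j x b = ∑ k, y k * ((b k : ℝ) * M.c k j * M.weight j x b) := by
  rw [form, Finset.sum_mul]
  exact Finset.sum_congr rfl fun k _ => by ring

theorem integrable_form_mul_weight_of_coeff {j : Fin d} {x : Fin d → ℝ}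
    (h : ∀ k, Integrable (fun b => (b k : ℝ) * M.c k j * M.weight j x b) (M.markLaw j))
    (y : Fin d → ℝ) :
    Integrable (fun b => M.form j y b * M.weight j x b) (M.markLaw j) := by
  simp_rw [form_mul_weight]
  exact integrable_finsetSum _ fun k _ => (h k).const_mul _

theorem integral_form_mul_weight {j : Fin d} {x : Fin d → ℝ}
    (h : ∀ k, Integrable (fun b => (b k : ℝ) * M.c k j * M.weight j x b) (M.markLaw j))
    (y : Fin d → ℝ) :
    ∫ b, M.form j y b * M.weight j x b ∂(M.markLaw j) = M.tilt y x j := by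
  simp_rw [form_mul_weight]
  rw [integral_finsetSum _ fun k _ => (h k).const_mul _]
  simp_rw [integral_const_mul]
  rfl

/-- `x` is a fixed point for the parameter `z`, and `r` is a positive left eigenvector, to the
eigenvalue one, of the Jacobian matrix of the fixed-point map at `x`. -/
structure IsCritical (M : Model d) (z r x : Fin d → ℝ) : Prop where
  r_pos : ∀ j, 0 < r j
  z_pos : ∀ j, 0 < z j
  integrable_weight : ∀ j, Integrable (M.weight j x) (M.markLaw j)
  integrable_coeff : ∀ k j,
    Integrable (fun b => (b k : ℝ) * M.c k j * M.weight j x b) (M.markLaw j)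
  fixed : ∀ j, z j * ∫ b, M.weight j x b ∂(M.markLaw j) = x j
  eigen : ∀ j, z j * M.tilt r x j = r j

theorem IsXHat.isCritical {r x : Fin d → ℝ} (hr : ∀ j, 0 < r j) (h : M.IsXHat r x) :
    M.IsCritical (M.zHat r x) r x := by
  have ht0 : ∀ j, 0 ≤ M.tilt r x j := fun j =>
    Finset.sum_nonneg fun k _ => mul_nonneg (hr k).le (integral_nonneg fun b =>
      mul_nonneg (coeff_nonneg b k j) (weight_pos j x b).le)
  have ht : ∀ j, 0 < M.tilt r x j := by
    intro j
    refine lt_of_le_of_ne (ht0 j) fun h0 => ?_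
    have h1 := h.eq j
    rw [← h0, mul_zero] at h1
    exact (mul_pos (hr j) (integral_weight_pos j (h.integrable_weight j))).ne h1
  refine ⟨hr, fun j => mul_pos (hr j) (inv_pos.2 (ht j)), h.integrable_weight,
    h.integrable_mul_weight, fun j => ?_, fun j => ?_⟩
  · have h1 := h.eq j
    have h2 := (ht j).ne'
    rw [zHat]
    field_simp
    linarith
  · have h2 := (ht j).ne'
    rw [zHat]
    field_simp

theorem IsCritical.isXHat {z r x : Fin d → ℝ} (h : M.IsCritical z r x) : M.IsXHat r x := by
  refine ⟨h.integrable_weight, h.integrable_coeff, fun j => ?_⟩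
  rw [← h.fixed j, ← h.eigen j]
  ring

theorem IsCritical.zHat_eq {z r x : Fin d → ℝ} (h : M.IsCritical z r x) : M.zHat r x = z := by
  funext j
  have ht : M.tilt r x j ≠ 0 := fun h0 => by
    have := h.eigen j
    rw [h0, mul_zero] at this
    exact (h.r_pos j).ne this
  rw [zHat, ← h.eigen j]
  field_simp

variable {z r x : Fin d → ℝ}

theorem IsCritical.integrable_form (h : M.IsCritical z r x) (j : Fin d) (y : Fin d → ℝ) :
    Integrable (fun b => M.form j y b * M.weight j x b) (M.markLaw j) :=
  integrable_form_mul_weight_of_coeff (fun k => h.integrable_coeff k j) y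

theorem IsCritical.integral_form (h : M.IsCritical z r x) (j : Fin d) :
    z j * ∫ b, M.form j r b * M.weight j x b ∂(M.markLaw j) = r j := by
  rw [integral_form_mul_weight (fun k => h.integrable_coeff k j), h.eigen]

/-- Strict convexity in integrated form: if the weight at `x'` has the same mean as its tangent
at `x`, the two weights agree almost surely. -/
theorem ae_form_eq_zero {j : Fin d} {x x' : Fin d → ℝ}
    (hx : Integrable (M.weight j x) (M.markLaw j))
    (hx' : Integrable (M.weight j x') (M.markLaw j))
    (hf : Integrable (fun b => M.form j (x' - x) b * M.weight j x b) (M.markLaw j))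
    (h : ∫ b, M.weight j x' b ∂(M.markLaw j) ≤ ∫ b, M.weight j x b ∂(M.markLaw j) +
      ∫ b, M.form j (x' - x) b * M.weight j x b ∂(M.markLaw j)) :
    ∀ᵐ b ∂(M.markLaw j), M.form j (x' - x) b = 0 := by
  have hD : Integrable (fun b => M.weight j x' b -
      (M.weight j x b + M.form j (x' - x) b * M.weight j x b)) (M.markLaw j) :=
    hx'.sub (hx.add hf)
  have hDI : ∫ b, (M.weight j x' b - (M.weight j x b + M.form j (x' - x) b * M.weight j x b))
      ∂(M.markLaw j) = ∫ b, M.weight j x' b ∂(M.markLaw j) - (∫ b, M.weight j x b ∂(M.markLaw j) +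
        ∫ b, M.form j (x' - x) b * M.weight j x b ∂(M.markLaw j)) := by
    rw [← integral_add hx hf]
    exact integral_sub hx' (hx.add hf)
  have hae := ae_eq_of_ae_le_of_lintegral_le (μ := M.markLaw j)
    (f := fun b => ENNReal.ofReal 0)
    (g := fun b => ENNReal.ofReal
      (M.weight j x' b - (M.weight j x b + M.form j (x' - x) b * M.weight j x b)))
    (Filter.Eventually.of_forall fun b => by simp) (by simp)
    hD.aestronglyMeasurable.aemeasurable.ennreal_ofReal (by
      rw [← ofReal_integral_eq_lintegral_ofReal hD
        (Filter.Eventually.of_forall fun b => sub_nonneg.2 (tangent_le_weight j x x' b)), hDI]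
      simpa using h)
  filter_upwards [hae] with b hb
  refine form_eq_zero_of_tangent_eq j (le_antisymm (tangent_le_weight j x x' b) ?_)
  have := ENNReal.ofReal_eq_zero.1 (hb.symm.trans (by simp))
  linarith

theorem integral_weight_eq_of_ae_form_eq_zero {j : Fin d} {x x' : Fin d → ℝ}
    (h : ∀ᵐ b ∂(M.markLaw j), M.form j (x' - x) b = 0) :
    ∫ b, M.weight j x' b ∂(M.markLaw j) = ∫ b, M.weight j x b ∂(M.markLaw j) := by
  refine integral_congr_ae ?_
  filter_upwards [h] with b hb
  rw [← weight_mul_exp j x x', hb]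
  simp

/-- Below a critical point, solutions that are ordered coincide. If `v - u ≥ 0` has its largest
ratio to `r` at `j`, then convexity of the weight, compared with its tangent at `x`, shows that
the `j`-th coordinates agree. -/
theorem IsCritical.eq_of_le (h : M.IsCritical z r x) {s u v : Fin d → ℝ} (hs0 : 0 ≤ s)
    (hs : s ≤ z) (huv : u ≤ v) (hvx : v ≤ x)
    (hu : ∀ j, u j = s j * ∫ b, M.weight j u b ∂(M.markLaw j))
    (hv : ∀ j, v j = s j * ∫ b, M.weight j v b ∂(M.markLaw j)) : u = v := by
  rcases isEmpty_or_nonempty (Fin d) with hd | hd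
  · exact Subsingleton.elim _ _
  obtain ⟨j, hj⟩ := Finite.exists_max fun j => (v j - u j) / r j
  set t := (v j - u j) / r j with ht
  have hyt : ∀ k, v k - u k ≤ t * r k := fun k => (div_le_iff₀ (h.r_pos k)).1 (hj k)
  have htj : v j - u j = t * r j := by rw [ht, div_mul_cancel₀ _ (h.r_pos j).ne']
  have ht0 : 0 ≤ t := div_nonneg (sub_nonneg.2 (huv j)) (h.r_pos j).le
  suffices hvj : v j ≤ u j by
    have ht00 : t = 0 := by
      have : t * r j ≤ 0 := by linarith
      nlinarith [h.r_pos j]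
    refine le_antisymm huv fun k => ?_
    have := hyt k
    rw [ht00, zero_mul] at this
    linarith
  by_contra hlt
  push Not at hlt
  have hvi := integrable_weight_of_le j hvx (h.integrable_weight j)
  have hui := integrable_weight_of_le j huv hvi
  have hsj : 0 < s j := by
    refine lt_of_le_of_ne (hs0 j) fun h0 => ?_
    have h1 := hu j
    have h2 := hv j
    rw [← h0, zero_mul] at h1 h2
    linarith
  -- the tangent at `v` has slope at most that at `x`
  have hfv0 : ∀ b, 0 ≤ M.form j (v - u) b := form_nonneg j (sub_nonneg.2 huv)
  have hneg : ∀ b, M.form j (u - v) b = - M.form j (v - u) b := fun b => by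
    rw [form_sub, form_sub]; ring
  have hfx : Integrable (fun b => M.form j (v - u) b * M.weight j x b) (M.markLaw j) :=
    h.integrable_form j _
  have hfv : Integrable (fun b => M.form j (v - u) b * M.weight j v b) (M.markLaw j) := by
    refine hfx.mono' ((measurable_form j _).mul (measurable_weight j v)).aestronglyMeasurable
      (Filter.Eventually.of_forall fun b => ?_)
    rw [Real.norm_of_nonneg (mul_nonneg (hfv0 b) (weight_pos j v b).le)]
    exact mul_le_mul_of_nonneg_left (weight_mono j hvx b) (hfv0 b)
  have hIv : ∫ b, M.form j (v - u) b * M.weight j v b ∂(M.markLaw j) ≤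
      ∫ b, M.form j (v - u) b * M.weight j x b ∂(M.markLaw j) :=
    integral_mono hfv hfx fun b => mul_le_mul_of_nonneg_left (weight_mono j hvx b) (hfv0 b)
  have hIx : ∫ b, M.form j (v - u) b * M.weight j x b ∂(M.markLaw j) ≤
      t * ∫ b, M.form j r b * M.weight j x b ∂(M.markLaw j) := by
    rw [← integral_const_mul]
    refine integral_mono hfx ((h.integrable_form j r).const_mul t) fun b => ?_
    have := form_mono (M := M) j (y := v - u) (y' := t • r) (fun k => hyt k) b
    rw [form_smul] at this
    have := mul_le_mul_of_nonneg_right this (weight_pos (M := M) j x b).le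
    linarith
  have hI0 : 0 ≤ ∫ b, M.form j (v - u) b * M.weight j v b ∂(M.markLaw j) :=
    integral_nonneg fun b => mul_nonneg (hfv0 b) (weight_pos j v b).le
  have hkey : s j * ∫ b, M.form j (v - u) b * M.weight j v b ∂(M.markLaw j) ≤
      s j * (∫ b, M.weight j v b ∂(M.markLaw j) - ∫ b, M.weight j u b ∂(M.markLaw j)) := by
    have h1 : s j * ∫ b, M.form j (v - u) b * M.weight j v b ∂(M.markLaw j) ≤
        z j * ∫ b, M.form j (v - u) b * M.weight j v b ∂(M.markLaw j) :=
      mul_le_mul_of_nonneg_right (hs j) hI0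
    have h2 := mul_le_mul_of_nonneg_left (hIv.trans hIx) (h.z_pos j).le
    have h3 := h.integral_form j
    have h4 : z j * (t * ∫ b, M.form j r b * M.weight j x b ∂(M.markLaw j)) = t * r j := by
      rw [← h3]; ring
    rw [mul_sub, ← hu j, ← hv j]
    linarith
  have hae := ae_form_eq_zero hvi hui (by simp_rw [hneg, neg_mul]; exact hfv.neg) (by
    simp_rw [hneg, neg_mul, integral_neg]
    linarith [le_of_mul_le_mul_left hkey hsj])
  have := integral_weight_eq_of_ae_form_eq_zero hae
  have h1 := hu j
  rw [this, ← hv j] at h1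
  linarith

/-- Above a critical point: a solution `v ≥ x` for a parameter `s ≥ z` is examined at a coordinate
where `v - x` has its smallest ratio to `r`. -/
theorem IsCritical.of_min_ratio (h : M.IsCritical z r x) {s v : Fin d → ℝ} (hs : z ≤ s)
    (hxv : x ≤ v) {j : Fin d} (hvi : Integrable (M.weight j v) (M.markLaw j))
    (hv : v j = s j * ∫ b, M.weight j v b ∂(M.markLaw j)) {t : ℝ}
    (hmin : ∀ k, t * r k ≤ v k - x k) (hj : v j - x j = t * r j) :
    s j = z j ∧ t = 0 ∧ ∀ k, 0 < M.H k j → v k = x k := by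
  have hxi := h.integrable_weight j
  have hf := h.integrable_form j (v - x)
  have hI : t * ∫ b, M.form j r b * M.weight j x b ∂(M.markLaw j) ≤
      ∫ b, M.form j (v - x) b * M.weight j x b ∂(M.markLaw j) := by
    rw [← integral_const_mul]
    refine integral_mono ((h.integrable_form j r).const_mul t) hf fun b => ?_
    have := form_mono (M := M) j (y := t • r) (y' := v - x) (fun k => hmin k) b
    rw [form_smul] at this
    have := mul_le_mul_of_nonneg_right this (weight_pos (M := M) j x b).le
    linarith
  have hT : ∫ b, M.weight j x b ∂(M.markLaw j) +
      ∫ b, M.form j (v - x) b * M.weight j x b ∂(M.markLaw j) ≤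
        ∫ b, M.weight j v b ∂(M.markLaw j) := by
    rw [← integral_add hxi hf]
    exact integral_mono (hxi.add hf) hvi fun b => tangent_le_weight j x v b
  have hwv := integral_weight_pos j hvi
  have hz := h.z_pos j
  have h3 := h.integral_form j
  have h4 := h.fixed j
  have h5 : z j * (t * ∫ b, M.form j r b * M.weight j x b ∂(M.markLaw j)) = t * r j := by
    rw [← h3]; ring
  have h6 := mul_le_mul_of_nonneg_left hI hz.le
  have h7 := mul_le_mul_of_nonneg_left hT hz.le
  have hsz : s j = z j := by
    refine le_antisymm ?_ (hs j)
    have : (s j - z j) * ∫ b, M.weight j v b ∂(M.markLaw j) ≤ 0 := by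
      rw [sub_mul, ← hv]
      linarith
    nlinarith
  have hae := ae_form_eq_zero hxi hvi hf (by
    have : z j * ∫ b, M.weight j v b ∂(M.markLaw j) ≤ z j *
      (∫ b, M.weight j x b ∂(M.markLaw j) +
        ∫ b, M.form j (v - x) b * M.weight j x b ∂(M.markLaw j)) := by
      rw [← hsz, ← hv, hsz]
      linarith
    exact le_of_mul_le_mul_left this hz)
  refine ⟨hsz, ?_, fun k hk => ?_⟩
  · have h8 := integral_weight_eq_of_ae_form_eq_zero hae
    rw [h8, hsz, h4] at hv
    have : t * r j = 0 := by linarith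
    exact (mul_eq_zero.1 this).resolve_right (h.r_pos j).ne'
  · by_contra hne
    have hpos : 0 < v k - x k := lt_of_le_of_ne (sub_nonneg.2 (hxv k)) (fun h0 => hne (by linarith))
    have h9 : ∀ᵐ b ∂(M.markLaw j), (b k : ℝ) * M.c k j = 0 := by
      filter_upwards [hae] with b hb
      have h10 := (Finset.sum_eq_zero_iff_of_nonneg fun m _ =>
        mul_nonneg (coeff_nonneg (M := M) b m j) (sub_nonneg.2 (hxv m))).1 hb k (Finset.mem_univ k)
      exact (mul_eq_zero.1 h10).resolve_right hpos.ne'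
    have h11 : M.H k j = 0 := by
      rw [H, ← integral_mul_const, integral_congr_ae h9]
      simp
    exact hk.ne' h11

/-- A solution above a critical point touches it in some coordinate. -/
theorem IsCritical.exists_coord_eq [Nonempty (Fin d)] (h : M.IsCritical z r x) {s v : Fin d → ℝ}
    (hs : z ≤ s) (hxv : x ≤ v) (hvi : ∀ j, Integrable (M.weight j v) (M.markLaw j))
    (hv : ∀ j, v j = s j * ∫ b, M.weight j v b ∂(M.markLaw j)) : ∃ j, s j = z j ∧ v j = x j := by
  obtain ⟨j, hj⟩ := Finite.exists_min fun j => (v j - x j) / r j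
  obtain ⟨h1, h2, -⟩ := h.of_min_ratio hs hxv (hvi j) (hv j)
    (fun k => (le_div_iff₀ (h.r_pos k)).1 (hj k)) (div_mul_cancel₀ _ (h.r_pos j).ne').symm
  refine ⟨j, h1, ?_⟩
  have := (div_eq_zero_iff.1 h2).resolve_right (h.r_pos j).ne'
  linarith

end Model

/-- In the graph of an irreducible matrix, a non-empty set of indices that is closed under
predecessors contains every index. -/
theorem mem_of_isIrreducible {ι : Type*} {A : Matrix ι ι ℝ} (hA : A.IsIrreducible) {J : Set ι}
    (hne : J.Nonempty) (hJ : ∀ j ∈ J, ∀ k, 0 < A k j → k ∈ J) (i : ι) : i ∈ J := by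
  obtain ⟨j, hj⟩ := hne
  let := A.toQuiver
  obtain ⟨p, -⟩ := hA.connected i j
  induction p with
  | nil => exact hj
  | cons p e ih => exact ih (hJ _ hj _ e.down)

namespace Model

variable {M : Model d} {z r x : Fin d → ℝ}

theorem IsCritical.eq_of_ge [Nonempty (Fin d)] (hirr : M.H.IsIrreducible)
    (h : M.IsCritical z r x) {s v : Fin d → ℝ}
    (hs : z ≤ s) (hxv : x ≤ v) (hvi : ∀ j, Integrable (M.weight j v) (M.markLaw j))
    (hv : ∀ j, v j = s j * ∫ b, M.weight j v b ∂(M.markLaw j)) : s = z ∧ v = x := by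
  have hstep : ∀ j, v j = x j → s j = z j ∧ ∀ k, 0 < M.H k j → v k = x k := by
    intro j hj
    obtain ⟨h1, -, h2⟩ := h.of_min_ratio hs hxv (hvi j) (hv j) (t := 0)
      (fun k => by simpa using hxv k) (by simp [hj])
    exact ⟨h1, h2⟩
  obtain ⟨j, -, hj⟩ := h.exists_coord_eq hs hxv hvi hv
  have hall : ∀ i, i ∈ {k | v k = x k} :=
    mem_of_isIrreducible hirr ⟨j, hj⟩ fun j hj k hk => (hstep j hj).2 k hk
  exact ⟨funext fun i => (hstep i (hall i)).1, funext hall⟩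

/-- A solution `u` is minimal as soon as there is a larger solution for a multiple `(1 + ε) s` of
the parameter: the increment `v` is then a strict supersolution of the linearised system at `u`,
against which the distance of `u` to a smaller solution is measured. -/
theorem eq_of_solution_scaled {s u u' w : Fin d → ℝ} {ε : ℝ} (hε : 0 < ε) (hs : 0 ≤ s)
    (hwu : w ≤ u) (huu' : u ≤ u')
    (hi : ∀ j, Integrable (M.weight j u') (M.markLaw j))
    (hw : ∀ j, w j = s j * ∫ b, M.weight j w b ∂(M.markLaw j))
    (hu : ∀ j, u j = s j * ∫ b, M.weight j u b ∂(M.markLaw j))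
    (hu' : ∀ j, u' j = (1 + ε) * s j * ∫ b, M.weight j u' b ∂(M.markLaw j)) : u = w := by
  rcases isEmpty_or_nonempty (Fin d) with hd | hd
  · exact Subsingleton.elim _ _
  have hui : ∀ j, Integrable (M.weight j u) (M.markLaw j) := fun j =>
    integrable_weight_of_le j huu' (hi j)
  have hwi : ∀ j, Integrable (M.weight j w) (M.markLaw j) := fun j =>
    integrable_weight_of_le j hwu (hui j)
  have hf : ∀ j, Integrable (fun b => M.form j (u' - u) b * M.weight j u b) (M.markLaw j) :=
    fun j => integrable_form_mul_weight j huu' (hi j)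
  have hI0 : ∀ j, 0 ≤ ∫ b, M.form j (u' - u) b * M.weight j u b ∂(M.markLaw j) := fun j =>
    integral_nonneg fun b =>
      mul_nonneg (form_nonneg j (sub_nonneg.2 huu') b) (weight_pos j u b).le
  have hv : ∀ j, 0 < s j →
      s j * ∫ b, M.form j (u' - u) b * M.weight j u b ∂(M.markLaw j) < u' j - u j := by
    intro j hj
    have h1 : ∫ b, M.weight j u b ∂(M.markLaw j) +
        ∫ b, M.form j (u' - u) b * M.weight j u b ∂(M.markLaw j) ≤
          ∫ b, M.weight j u' b ∂(M.markLaw j) := by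
      rw [← integral_add (hui j) (hf j)]
      exact integral_mono ((hui j).add (hf j)) (hi j) fun b => tangent_le_weight j u u' b
    have h2 := mul_le_mul_of_nonneg_left h1 hj.le
    have h3 := mul_pos (mul_pos hε hj) (integral_weight_pos j (hi j))
    rw [hu' j, add_mul, add_mul, one_mul]
    have h4 := hu j
    linarith
  have hzero : ∀ j, s j = 0 → u j = 0 ∧ w j = 0 ∧ u' j = 0 := fun j hj =>
    ⟨by rw [hu j, hj, zero_mul], by rw [hw j, hj, zero_mul], by rw [hu' j, hj]; simp⟩
  -- where `s j = 0`, the quotient is `0 / 0 = 0` and does not affect the maximum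
  obtain ⟨j, hj⟩ := Finite.exists_max fun j => (u j - w j) / (u' j - u j)
  set t := (u j - w j) / (u' j - u j) with ht
  have ht0 : 0 ≤ t := div_nonneg (sub_nonneg.2 (hwu j)) (sub_nonneg.2 (huu' j))
  have hyt : ∀ k, u k - w k ≤ t * (u' k - u k) := by
    intro k
    rcases (hs k).eq_or_lt with h0 | h0
    · obtain ⟨h1, h2, h3⟩ := hzero k h0.symm
      simp [h1, h2, h3]
    · refine (div_le_iff₀ ?_).1 (hj k)
      exact lt_of_le_of_lt (mul_nonneg h0.le (hI0 k)) (hv k h0)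
  have ht00 : t = 0 := by
    by_contra hne
    have htpos : 0 < t := lt_of_le_of_ne ht0 (Ne.symm hne)
    rcases (hs j).eq_or_lt with h0 | h0
    · obtain ⟨h1, h2, -⟩ := hzero j h0.symm
      exact hne (by rw [ht, h1, h2]; simp)
    have hvj := hv j h0
    have hvpos : 0 < u' j - u j := lt_of_le_of_lt (mul_nonneg h0.le (hI0 j)) hvj
    have hle : ∫ b, M.weight j u b ∂(M.markLaw j) - ∫ b, M.weight j w b ∂(M.markLaw j) ≤
        t * ∫ b, M.form j (u' - u) b * M.weight j u b ∂(M.markLaw j) := by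
      rw [← integral_sub (hui j) (hwi j), ← integral_const_mul]
      refine integral_mono ((hui j).sub (hwi j)) ((hf j).const_mul t) fun b => ?_
      have h1 := tangent_le_weight (M := M) j u w b
      have h2 : M.form j (w - u) b = - M.form j (u - w) b := by rw [form_sub, form_sub]; ring
      have h3 := form_mono (M := M) j (y := u - w) (y' := t • (u' - u)) (fun k => hyt k) b
      rw [form_smul] at h3
      have h4 := mul_le_mul_of_nonneg_right h3 (weight_pos (M := M) j u b).le
      rw [h2] at h1
      simp only
      linarith
    have h5 := mul_le_mul_of_nonneg_left hle h0.le
    rw [mul_sub, ← hu j, ← hw j] at h5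
    have h6 : u j - w j = t * (u' j - u j) := by rw [ht, div_mul_cancel₀ _ hvpos.ne']
    have h7 := mul_lt_mul_of_pos_left hvj htpos
    linarith
  refine le_antisymm (fun k => ?_) hwu
  have := hyt k
  rw [ht00, zero_mul] at this
  linarith

end Model

namespace Model

variable {M : Model d}

/-! ### The domain of the minimal solution below and above a critical point -/

variable (M) in
/-- The set of parameters at which the minimal solution is finite. -/
def domain : Set (Fin d → ℝ) := {z | 0 ≤ z ∧ ∀ j, M.minSol z j < ⊤}

variable (M) in
/-- The minimal solution as a real vector. -/
noncomputable def sol (z : Fin d → ℝ) (j : Fin d) : ℝ := (M.minSol z j).toReal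

theorem minSol_mono {z z' : Fin d → ℝ} (h : z ≤ z') (j : Fin d) :
    M.minSol z j ≤ M.minSol z' j := by
  suffices hn : ∀ n, M.iter (fun l => ENNReal.ofReal (z l)) n ≤
      M.iter (fun l => ENNReal.ofReal (z' l)) n from iSup_mono fun n => hn n j
  intro n
  induction n with
  | zero => exact le_rfl
  | succ n ih =>
    intro j
    exact mul_le_mul' (ENNReal.ofReal_le_ofReal (h j)) (M.offspring_mono j ih)

theorem mem_domain_of_le {z z' : Fin d → ℝ} (hz : 0 ≤ z) (h : z ≤ z') (hz' : z' ∈ M.domain) :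
    z ∈ M.domain :=
  ⟨hz, fun j => (minSol_mono h j).trans_lt (hz'.2 j)⟩

theorem sol_nonneg (z : Fin d → ℝ) : 0 ≤ M.sol z := fun _ => ENNReal.toReal_nonneg

theorem sol_mono {z z' : Fin d → ℝ} (h : z ≤ z') (hz' : z' ∈ M.domain) : M.sol z ≤ M.sol z' :=
  fun j => ENNReal.toReal_mono (hz'.2 j).ne (minSol_mono h j)

theorem integrable_weight_sol {z : Fin d → ℝ} (h : z ∈ M.domain) {j : Fin d} (hz : 0 < z j) :
    Integrable (M.weight j (M.sol z)) (M.markLaw j) :=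
  integrable_weight_minSol h.2 hz

theorem sol_eq {z : Fin d → ℝ} (h : z ∈ M.domain) {j : Fin d}
    (hi : Integrable (M.weight j (M.sol z)) (M.markLaw j)) :
    M.sol z j = z j * ∫ b, M.weight j (M.sol z) b ∂(M.markLaw j) :=
  toReal_minSol_eq h.1 h.2 hi

theorem mem_domain_of_supersolution {z x : Fin d → ℝ} (hz : 0 ≤ z) (hx : 0 ≤ x)
    (hi : ∀ j, Integrable (M.weight j x) (M.markLaw j))
    (h : ∀ j, z j * ∫ b, M.weight j x b ∂(M.markLaw j) ≤ x j) :
    z ∈ M.domain ∧ M.sol z ≤ x :=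
  ⟨⟨hz, fun j => (minSol_le hx hi h j).trans_lt ENNReal.ofReal_lt_top⟩,
    fun j => ENNReal.toReal_le_of_le_ofReal (hx j) (minSol_le hx hi h j)⟩

theorem mem_domain_of_solution {z x : Fin d → ℝ} (hz : 0 ≤ z)
    (h : ∀ j, Integrable (M.weight j x) (M.markLaw j) ∧
      x j = z j * ∫ b, M.weight j x b ∂(M.markLaw j)) :
    z ∈ M.domain ∧ M.sol z ≤ x := by
  refine mem_domain_of_supersolution hz (fun j => ?_) (fun j => (h j).1) fun j => (h j).2.ge
  rw [(h j).2]
  exact mul_nonneg (hz j) (integral_weight_pos j (h j).1).le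

section Critical

variable {z r x : Fin d → ℝ}

theorem IsCritical.mem_domain (h : M.IsCritical z r x) : z ∈ M.domain ∧ M.sol z ≤ x :=
  mem_domain_of_solution (fun j => (h.z_pos j).le) fun j =>
    ⟨h.integrable_weight j, (h.fixed j).symm⟩

theorem IsCritical.mem_domain_of_le (h : M.IsCritical z r x) {s : Fin d → ℝ} (hs0 : 0 ≤ s)
    (hs : s ≤ z) : s ∈ M.domain ∧ M.sol s ≤ x :=
  ⟨Model.mem_domain_of_le hs0 hs h.mem_domain.1,
    (sol_mono hs h.mem_domain.1).trans h.mem_domain.2⟩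

theorem IsCritical.isFixedPointOn (h : M.IsCritical z r x) :
    M.IsFixedPointOn M.sol (Set.Icc 0 z) := by
  intro s hs j
  have h1 := h.mem_domain_of_le hs.1 hs.2
  have h2 := integrable_weight_of_le j h1.2 (h.integrable_weight j)
  exact ⟨h2, sol_eq h1.1 h2⟩

theorem IsCritical.sol_eq (h : M.IsCritical z r x) : M.sol z = x :=
  h.eq_of_le (fun j => (h.z_pos j).le) le_rfl h.mem_domain.2 le_rfl
    (fun j => (h.isFixedPointOn z ⟨fun j => (h.z_pos j).le, le_rfl⟩ j).2)
    (fun j => (h.fixed j).symm)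

theorem IsCritical.solution_of_ge (h : M.IsCritical z r x) {s : Fin d → ℝ} (hs : z ≤ s)
    (hsD : s ∈ M.domain) :
    x ≤ M.sol s ∧ (∀ j, Integrable (M.weight j (M.sol s)) (M.markLaw j)) ∧
      ∀ j, M.sol s j = s j * ∫ b, M.weight j (M.sol s) b ∂(M.markLaw j) := by
  have hi : ∀ j, Integrable (M.weight j (M.sol s)) (M.markLaw j) := fun j =>
    integrable_weight_sol hsD ((h.z_pos j).trans_le (hs j))
  exact ⟨h.sol_eq.symm.le.trans (sol_mono hs hsD), hi, fun j => Model.sol_eq hsD (hi j)⟩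

theorem IsCritical.notMem_domain [Nonempty (Fin d)] (h : M.IsCritical z r x) {s : Fin d → ℝ}
    (hs : ∀ j, z j < s j) : s ∉ M.domain := by
  intro hsD
  obtain ⟨h1, h2, h3⟩ := h.solution_of_ge (fun j => (hs j).le) hsD
  obtain ⟨j, hj, -⟩ := h.exists_coord_eq (fun j => (hs j).le) h1 h2 h3
  exact (hs j).ne' hj

theorem IsCritical.eq_of_mem_domain [Nonempty (Fin d)] (hirr : M.H.IsIrreducible)
    (h : M.IsCritical z r x) {s : Fin d → ℝ} (hs : z ≤ s) (hsD : s ∈ M.domain) : s = z := by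
  obtain ⟨h1, h2, h3⟩ := h.solution_of_ge hs hsD
  exact (h.eq_of_ge hirr hs h1 h2 h3).1

theorem notMem_interior_of_smul {D : Set (Fin d → ℝ)} {z : Fin d → ℝ}
    (h : ∀ t : ℝ, 1 < t → t • z ∉ D) : z ∉ interior D := by
  intro hz
  have hc : Filter.Tendsto (fun t : ℝ => t • z) (nhdsWithin 1 (Set.Ioi 1)) (nhds z) := by
    have : Filter.Tendsto (fun t : ℝ => t • z) (nhds 1) (nhds ((1 : ℝ) • z)) :=
      (continuous_id.smul continuous_const).tendsto 1
    rw [one_smul] at this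
    exact this.mono_left nhdsWithin_le_nhds
  obtain ⟨t, h1, h2⟩ := ((hc.eventually (mem_interior_iff_mem_nhds.1 hz)).and
    self_mem_nhdsWithin).exists
  exact h t h2 h1

theorem IsCritical.mem_frontier [Nonempty (Fin d)] (h : M.IsCritical z r x) :
    z ∈ frontier M.domain := by
  refine ⟨subset_closure h.mem_domain.1, notMem_interior_of_smul fun t ht => ?_⟩
  refine h.notMem_domain fun j => ?_
  simpa using mul_lt_mul_of_pos_right ht (h.z_pos j)

theorem IsCritical.unique_lt (h : M.IsCritical z r x) {f : (Fin d → ℝ) → Fin d → ℝ}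
    (hmono : MonotoneOn f {s | 0 ≤ s ∧ ∀ j, s j < z j})
    (hfix : M.IsFixedPointOn f {s | 0 ≤ s ∧ ∀ j, s j < z j}) :
    Set.EqOn f M.sol {s | 0 ≤ s ∧ ∀ j, s j < z j} := by
  intro s hs
  have hev : ∀ᶠ t : ℝ in nhdsWithin 0 (Set.Ioi 0), ∀ j, (1 + t) * s j < z j := by
    refine Filter.eventually_all.2 fun j => ?_
    have : Filter.Tendsto (fun t : ℝ => (1 + t) * s j) (nhds 0) (nhds ((1 + 0) * s j)) :=
      ((continuous_const.add continuous_id).mul continuous_const).tendsto 0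
    rw [add_zero, one_mul] at this
    exact (this.mono_left nhdsWithin_le_nhds).eventually_lt_const (hs.2 j)
  obtain ⟨ε, h1, hε⟩ := (hev.and self_mem_nhdsWithin).exists
  have hε' : (0 : ℝ) < ε := hε
  have hs' : (1 + ε) • s ∈ {s : Fin d → ℝ | 0 ≤ s ∧ ∀ j, s j < z j} :=
    ⟨smul_nonneg (by linarith) hs.1, h1⟩
  have hle : s ≤ (1 + ε) • s := fun j => by
    have := hs.1 j
    simp only [Pi.zero_apply] at this
    simp only [Pi.smul_apply, smul_eq_mul]
    nlinarith
  refine eq_of_solution_scaled hε' hs.1 (mem_domain_of_solution hs.1 (hfix s hs)).2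
    (hmono hs hs' hle) (fun j => (hfix _ hs' j).1) (fun j => ?_) (fun j => (hfix s hs j).2)
    (fun j => (hfix _ hs' j).2)
  exact (h.isFixedPointOn s ⟨hs.1, fun j => (hs.2 j).le⟩ j).2

theorem IsCritical.unique_le [Nonempty (Fin d)] (hirr : M.H.IsIrreducible)
    (h : M.IsCritical z r x) {f : (Fin d → ℝ) → Fin d → ℝ}
    (hmono : MonotoneOn f (Set.Icc 0 z)) (hfix : M.IsFixedPointOn f (Set.Icc 0 z)) :
    Set.EqOn f M.sol (Set.Icc 0 z) := by
  intro s hs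
  have hz : z ∈ Set.Icc 0 z := ⟨fun j => (h.z_pos j).le, le_rfl⟩
  have hfz : f z = x := by
    refine (h.eq_of_ge hirr le_rfl ?_ (fun j => (hfix z hz j).1) fun j => (hfix z hz j).2).2
    exact h.sol_eq.symm.le.trans (mem_domain_of_solution hz.1 (hfix z hz)).2
  refine (h.eq_of_le hs.1 hs.2 (mem_domain_of_solution hs.1 (hfix s hs)).2
    ((hmono hs hz hs.2).trans hfz.le) (fun j => (h.isFixedPointOn s hs j).2)
    fun j => (hfix s hs j).2).symm

end Critical

end Model

/-! ### Positive left eigenvectors of irreducible matrices -/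

section PerronFrobenius

open scoped Matrix

variable {ι : Type*} [Fintype ι] [DecidableEq ι]

theorem matrix_pow_nonneg {A : Matrix ι ι ℝ} (hA : ∀ i j, 0 ≤ A i j) (n : ℕ) (i j : ι) :
    0 ≤ (A ^ n) i j := by
  induction n generalizing i j with
  | zero => rw [pow_zero, Matrix.one_apply]; split_ifs <;> norm_num
  | succ n ih =>
    rw [pow_succ, Matrix.mul_apply]
    exact Finset.sum_nonneg fun k _ => mul_nonneg (ih i k) (hA k j)

/-- A sum of powers of an irreducible matrix is entrywise positive. -/
theorem exists_sum_pow_pos {A : Matrix ι ι ℝ} (hA : A.IsIrreducible) :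
    ∃ n : ι × ι → ℕ, ∀ i j, 0 < (∑ p, A ^ n p) i j := by
  have hpow : ∀ p : ι × ι, ∃ n : ℕ, 0 < (A ^ n) p.1 p.2 := by
    rintro ⟨i, j⟩
    refine mem_of_isIrreducible hA (J := {i | ∃ n : ℕ, 0 < (A ^ n) i j}) ⟨j, 0, by simp⟩ ?_ i
    rintro k ⟨n, hn⟩ l hl
    refine ⟨n + 1, ?_⟩
    rw [pow_succ', Matrix.mul_apply]
    exact (mul_pos hl hn).trans_le (Finset.single_le_sum
      (f := fun k => A l k * (A ^ n) k j)
      (fun m _ => mul_nonneg (hA.nonneg l m) (matrix_pow_nonneg hA.nonneg n m j))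
      (Finset.mem_univ k))
  choose n hn using hpow
  refine ⟨n, fun i j => ?_⟩
  rw [Matrix.sum_apply]
  exact (hn (i, j)).trans_le (Finset.single_le_sum (f := fun p => (A ^ n p) i j)
    (fun p _ => matrix_pow_nonneg hA.nonneg _ i j) (Finset.mem_univ (i, j)))

omit [DecidableEq ι] in
theorem vecMul_pos {Q : Matrix ι ι ℝ} (hQ : ∀ i j, 0 < Q i j) {v : ι → ℝ} (hv : 0 ≤ v)
    (hne : v ≠ 0) (j : ι) : 0 < (v ᵥ* Q) j := by
  obtain ⟨k, hk⟩ := Function.ne_iff.1 hne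
  refine Finset.sum_pos' (fun i _ => mul_nonneg (hv i) (hQ i j).le) ⟨k, Finset.mem_univ k, ?_⟩
  exact mul_pos (lt_of_le_of_ne (hv k) (Ne.symm hk)) (hQ k j)

/-- Perron–Frobenius: the largest `c` with `c v ≤ v A` for some `v` in the simplex is an
eigenvalue, and the maximiser is a positive left eigenvector. -/
theorem exists_pos_left_eigenvector [Nonempty ι] {A : Matrix ι ι ℝ} (hA : A.IsIrreducible) :
    ∃ (r : ι → ℝ) (c : ℝ), (∀ j, 0 < r j) ∧ r ᵥ* A = c • r := by
  let K : Set (ℝ × (ι → ℝ)) :=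
    {p | p.2 ∈ stdSimplex ℝ ι ∧ 0 ≤ p.1 ∧ ∀ j, p.1 * p.2 j ≤ (p.2 ᵥ* A) j}
  have hKc : IsCompact K := by
    have hsub : K ⊆ Set.Icc 0 (∑ j, ∑ k, A k j) ×ˢ stdSimplex ℝ ι := by
      rintro ⟨c, v⟩ ⟨hv, hc, h⟩
      refine ⟨⟨hc, ?_⟩, hv⟩
      calc c = ∑ j, c * v j := by rw [← Finset.mul_sum, hv.2, mul_one]
        _ ≤ ∑ j, (v ᵥ* A) j := Finset.sum_le_sum fun j _ => h j
        _ ≤ ∑ j, ∑ k, A k j := Finset.sum_le_sum fun j _ => Finset.sum_le_sum fun k _ => by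
          have h1 : v k ≤ 1 := by
            rw [← hv.2]
            exact Finset.single_le_sum (fun i _ => hv.1 i) (Finset.mem_univ k)
          exact mul_le_of_le_one_left (hA.nonneg k j) h1
    refine (isCompact_Icc.prod (isCompact_stdSimplex ℝ ι)).of_isClosed_subset ?_ hsub
    have h1 : IsClosed {p : ℝ × (ι → ℝ) | p.2 ∈ stdSimplex ℝ ι} :=
      (isClosed_stdSimplex ℝ ι).preimage continuous_snd
    have h2 : IsClosed {p : ℝ × (ι → ℝ) | 0 ≤ p.1} := isClosed_le continuous_const continuous_fst
    have h3 : IsClosed {p : ℝ × (ι → ℝ) | ∀ j, p.1 * p.2 j ≤ (p.2 ᵥ* A) j} := by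
      have : {p : ℝ × (ι → ℝ) | ∀ j, p.1 * p.2 j ≤ (p.2 ᵥ* A) j} =
          ⋂ j, {p : ℝ × (ι → ℝ) | p.1 * p.2 j ≤ (p.2 ᵥ* A) j} := by ext; simp
      rw [this]
      refine isClosed_iInter fun j => isClosed_le (by fun_prop) ?_
      simp only [Matrix.vecMul, dotProduct]
      fun_prop
    exact h1.inter (h2.inter h3)
  have hKne : K.Nonempty := by
    obtain ⟨i⟩ := ‹Nonempty ι›
    refine ⟨(0, Pi.single i 1), single_mem_stdSimplex ℝ i, le_rfl, fun j => ?_⟩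
    rw [zero_mul]
    exact Finset.sum_nonneg fun k _ =>
      mul_nonneg ((single_mem_stdSimplex ℝ i).1 k) (hA.nonneg k j)
  obtain ⟨⟨c, v⟩, ⟨hv, hc, hcv⟩, hmax⟩ := hKc.exists_isMaxOn hKne continuous_fst.continuousOn
  have hv0 : v ≠ 0 := by
    rintro rfl
    simpa using hv.2
  obtain ⟨n, hQ⟩ := exists_sum_pow_pos hA
  set Q := ∑ p, A ^ n p with hQdef
  have hcomm : Q * A = A * Q := by
    rw [hQdef, Finset.sum_mul, Finset.mul_sum]
    exact Finset.sum_congr rfl fun p _ => (pow_succ A (n p)).symm.trans (pow_succ' A (n p))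
  have heig : v ᵥ* A = c • v := by
    by_contra hne
    -- multiplication by the positive matrix `Q` makes all inequalities `c v ≤ v A` strict
    have hδ := vecMul_pos hQ (v := v ᵥ* A - c • v) (fun j => sub_nonneg.2 (hcv j))
      (sub_ne_zero.2 hne)
    have hw := vecMul_pos hQ (fun j => hv.1 j) hv0
    set w := v ᵥ* Q with hwdef
    have hδw : (v ᵥ* A - c • v) ᵥ* Q = w ᵥ* A - c • w := by
      rw [Matrix.sub_vecMul, Matrix.vecMul_vecMul, ← hcomm, ← Matrix.vecMul_vecMul,
        Matrix.smul_vecMul]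
    rw [hδw] at hδ
    obtain ⟨j0, hj0⟩ := Finite.exists_min fun j => (w ᵥ* A - c • w) j / w j
    set ε := (w ᵥ* A - c • w) j0 / w j0
    have hε : 0 < ε := div_pos (hδ j0) (hw j0)
    have hS : 0 < ∑ j, w j := Finset.sum_pos (fun j _ => hw j) Finset.univ_nonempty
    have hmem : (c + ε, (∑ j, w j)⁻¹ • w) ∈ K := by
      refine ⟨⟨fun j => mul_nonneg (inv_nonneg.2 hS.le) (hw j).le, ?_⟩, by positivity, fun j => ?_⟩
      · simp only [Pi.smul_apply, smul_eq_mul]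
        rw [← Finset.mul_sum, inv_mul_cancel₀ hS.ne']
      · have h1 := (le_div_iff₀ (hw j)).1 (hj0 j)
        simp only [Pi.sub_apply, Pi.smul_apply, smul_eq_mul] at h1
        simp only [Matrix.smul_vecMul, Pi.smul_apply, smul_eq_mul]
        have h2 : (c + ε) * w j ≤ (w ᵥ* A) j := by rw [add_mul]; linarith
        have h3 := mul_le_mul_of_nonneg_left h2 (inv_nonneg.2 hS.le)
        linarith
    have h4 : c + ε ≤ c := hmax hmem
    linarith
  refine ⟨v, c, fun j => lt_of_le_of_ne (hv.1 j) fun h0 => ?_, heig⟩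
  have hpow : ∀ m : ℕ, v ᵥ* A ^ m = c ^ m • v := by
    intro m
    induction m with
    | zero => simp
    | succ m ih =>
      rw [pow_succ, ← Matrix.vecMul_vecMul, ih, Matrix.smul_vecMul, heig, smul_smul, pow_succ]
  have h1 := vecMul_pos hQ (fun j => hv.1 j) hv0 j
  rw [hQdef, Matrix.vecMul_sum, Finset.sum_apply] at h1
  simp [hpow, ← h0] at h1

end PerronFrobenius

/-! ### Irreducibility through the pattern of positive entries -/

section Irreducible

variable {ι : Type*} {A B : Matrix ι ι ℝ}

theorem isIrreducible_of_pos (hA : A.IsIrreducible)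
    (hB : ∀ i j, 0 ≤ B i j) (h : ∀ i j, 0 < A i j → 0 < B i j) : B.IsIrreducible := by
  refine ⟨hB, fun i j => ?_⟩
  have hmap : ∀ {j : ι} (p : @Quiver.Path ι A.toQuiver i j),
      ∃ q : @Quiver.Path ι B.toQuiver i j,
        @Quiver.Path.length ι B.toQuiver i j q = @Quiver.Path.length ι A.toQuiver i j p := by
    intro j p
    induction p with
    | nil => exact ⟨@Quiver.Path.nil ι B.toQuiver i, rfl⟩
    | cons p e ih =>
      obtain ⟨q, hq⟩ := ih
      exact ⟨@Quiver.Path.cons ι B.toQuiver _ _ _ q ⟨h _ _ e.down⟩, congrArg (· + 1) hq⟩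
  obtain ⟨p, hp⟩ := hA.connected i j
  obtain ⟨q, hq⟩ := hmap p
  exact ⟨q, hq ▸ hp⟩

theorem exists_pos_of_isIrreducible (hA : A.IsIrreducible) (k : ι) : ∃ j, 0 < A k j := by
  let := A.toQuiver
  have hpath : ∀ {j : ι} (p : Quiver.Path k j), 0 < p.length → ∃ j, 0 < A k j := by
    intro j p
    induction p with
    | nil => intro h; exact absurd h (lt_irrefl 0)
    | cons p e ih =>
      intro _
      cases p with
      | nil => exact ⟨_, e.down⟩
      | cons p' e' => exact ih (Nat.succ_pos _)
  obtain ⟨p, hp⟩ := hA.connected k k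
  exact hpath p hp

end Irreducible

namespace Model

variable {M : Model d}

/-! ### Interior points of the domain -/

theorem mgfFinite_iff (j : Fin d) (x : Fin d → ℝ) :
    M.MgfFinite j (fun m => M.c m j * (x m - 1)) ↔ Integrable (M.weight j x) (M.markLaw j) := by
  unfold MgfFinite weight
  simp_rw [mul_assoc]

theorem exists_integrable_weight_add {j : Fin d}
    (hopen : IsOpen {ϑ : Fin d → ℝ | M.MgfFinite j ϑ}) {x : Fin d → ℝ}
    (hi : Integrable (M.weight j x) (M.markLaw j)) (r : Fin d → ℝ) :
    ∀ᶠ s : ℝ in nhds 0, Integrable (M.weight j (x + s • r)) (M.markLaw j) := by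
  have hc : Continuous fun s : ℝ => fun m => M.c m j * ((x + s • r) m - 1) := by
    simp only [Pi.add_apply, Pi.smul_apply, smul_eq_mul]
    fun_prop
  have h0 : (fun s : ℝ => fun m => M.c m j * ((x + s • r) m - 1)) 0 ∈
      {ϑ : Fin d → ℝ | M.MgfFinite j ϑ} := by
    have := (mgfFinite_iff j x).2 hi
    simpa using this
  filter_upwards [hc.continuousAt.eventually (hopen.mem_nhds h0)] with s hs
  exact (mgfFinite_iff j _).1 hs

theorem integrable_coeff_of_isOpen {j : Fin d}
    (hopen : IsOpen {ϑ : Fin d → ℝ | M.MgfFinite j ϑ}) {x : Fin d → ℝ}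
    (hi : Integrable (M.weight j x) (M.markLaw j)) (k : Fin d) :
    Integrable (fun b => (b k : ℝ) * M.c k j * M.weight j x b) (M.markLaw j) := by
  obtain ⟨e, he⟩ : ∃ e : Fin d → ℝ, e = Pi.single k 1 := ⟨_, rfl⟩
  have he0 : 0 ≤ e := by
    rw [he]
    exact Pi.single_nonneg.2 zero_le_one
  obtain ⟨s, h1, h2⟩ := (((exists_integrable_weight_add hopen hi e).filter_mono
    nhdsWithin_le_nhds).and (self_mem_nhdsWithin (s := Set.Ioi (0 : ℝ)))).exists
  have hs : (0 : ℝ) < s := h2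
  have h3 := integrable_form_mul_weight j (le_add_of_nonneg_right (smul_nonneg hs.le he0)) h1
  have h4 : ∀ b, M.form j (x + s • e - x) b = s * ((b k : ℝ) * M.c k j) := by
    intro b
    rw [add_sub_cancel_left, form_smul, form, Finset.sum_eq_single k]
    · simp [he]
    · intro m _ hm
      simp [he, hm]
    · simp
  simp_rw [h4, mul_assoc s] at h3
  have := h3.const_mul s⁻¹
  simpa only [inv_mul_cancel_left₀ hs.ne'] using this

/-- The integral that represents the derivative of the mean weight in a non-negative direction `r`
is continuous along this direction at `x`, provided that the weight remains integrable a little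
further. -/
theorem continuousAt_integral_form_mul_weight {j : Fin d} {x r : Fin d → ℝ} (hr : 0 ≤ r) {ε : ℝ}
    (hε : 0 < ε) (hi : Integrable (M.weight j (x + ε • r)) (M.markLaw j)) :
    ContinuousAt (fun s : ℝ => ∫ b, M.form j r b * M.weight j (x + s • r) b ∂(M.markLaw j)) 0 := by
  have hle : ∀ s t : ℝ, s ≤ t → x + s • r ≤ x + t • r := fun s t hst m => by
    have := mul_le_mul_of_nonneg_right hst (hr m)
    simpa using this
  have hbound : Integrable (fun b => M.form j r b * M.weight j (x + (ε / 2) • r) b)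
      (M.markLaw j) := by
    have h1 := integrable_form_mul_weight j (hle (ε / 2) ε (by linarith)) hi
    have h2 : x + ε • r - (x + (ε / 2) • r) = (ε / 2) • r := by
      funext m
      simp only [Pi.sub_apply, Pi.add_apply, Pi.smul_apply, smul_eq_mul]
      ring
    simp_rw [h2, form_smul, mul_assoc] at h1
    have := h1.const_mul (ε / 2)⁻¹
    simpa only [inv_mul_cancel_left₀ (half_pos hε).ne'] using this
  refine continuousAt_of_dominated
    (bound := fun b => M.form j r b * M.weight j (x + (ε / 2) • r) b)
    (Filter.Eventually.of_forall fun s =>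
      ((measurable_form j r).mul (measurable_weight j _)).aestronglyMeasurable)
    ?_ hbound (Filter.Eventually.of_forall fun b => ?_)
  · filter_upwards [eventually_lt_nhds (half_pos hε)] with s hs
    refine Filter.Eventually.of_forall fun b => ?_
    rw [Real.norm_of_nonneg (mul_nonneg (form_nonneg j hr b) (weight_pos j _ b).le)]
    exact mul_le_mul_of_nonneg_left (weight_mono j (hle _ _ hs.le) b) (form_nonneg j hr b)
  · refine Continuous.continuousAt (continuous_const.mul ?_)
    simp only [weight, Pi.add_apply, Pi.smul_apply, smul_eq_mul]
    fun_prop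

/-- Dichotomy at a point of the domain: either a multiple of the positive left eigenvector of the
Jacobian matrix can be added to the solution to give a strict supersolution, so that the point
is interior, or the eigenvalue is one and the point is critical; an eigenvalue above one would
give a supersolution below the minimal solution. -/
theorem mem_interior_or_isCritical [Nonempty (Fin d)] (hirr : M.H.IsIrreducible)
    (hopen : ∀ j, IsOpen {ϑ : Fin d → ℝ | M.MgfFinite j ϑ}) {z : Fin d → ℝ} (hz : ∀ j, 0 < z j)
    (hD : z ∈ M.domain) : z ∈ interior M.domain ∨ ∃ r, M.IsCritical z r (M.sol z) := by
  classical
  set x := M.sol z with hx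
  have hi : ∀ j, Integrable (M.weight j x) (M.markLaw j) := fun j =>
    integrable_weight_sol hD (hz j)
  have hfix : ∀ j, x j = z j * ∫ b, M.weight j x b ∂(M.markLaw j) := fun j => sol_eq hD (hi j)
  have hxpos : ∀ j, 0 < x j := fun j => by
    rw [hfix j]; exact mul_pos (hz j) (integral_weight_pos j (hi j))
  have hcoeff : ∀ k j, Integrable (fun b => (b k : ℝ) * M.c k j * M.weight j x b)
      (M.markLaw j) := fun k j => integrable_coeff_of_isOpen (hopen j) (hi j) k
  -- the Jacobian matrix of the fixed-point map at the solution
  let A : Matrix (Fin d) (Fin d) ℝ := fun k j =>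
    z j * ∫ b, (b k : ℝ) * M.c k j * M.weight j x b ∂(M.markLaw j)
  have hA0 : ∀ k j, 0 ≤ A k j := fun k j => mul_nonneg (hz j).le (integral_nonneg fun b =>
    mul_nonneg (coeff_nonneg b k j) (weight_pos j x b).le)
  have hAirr : A.IsIrreducible := by
    refine isIrreducible_of_pos hirr hA0 fun k j hkj => mul_pos (hz j) ?_
    refine lt_of_le_of_ne (integral_nonneg fun b =>
      mul_nonneg (coeff_nonneg b k j) (weight_pos j x b).le) fun h0 => hkj.ne' ?_
    have h1 := (integral_eq_zero_iff_of_nonneg (fun b =>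
      mul_nonneg (coeff_nonneg b k j) (weight_pos j x b).le) (hcoeff k j)).1 h0.symm
    rw [H, ← integral_mul_const]
    refine integral_eq_zero_of_ae ?_
    filter_upwards [h1] with b hb
    exact (mul_eq_zero.1 hb).resolve_right (weight_pos j x b).ne'
  obtain ⟨r, c, hr, heig⟩ := exists_pos_left_eigenvector hAirr
  have heig' : ∀ j, z j * M.tilt r x j = c * r j := by
    intro j
    have h1 := congrFun heig j
    simp only [Matrix.vecMul, dotProduct, Pi.smul_apply, smul_eq_mul, A] at h1
    rw [← h1, tilt, Finset.mul_sum]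
    exact Finset.sum_congr rfl fun k _ => by ring
  have hr0 : 0 ≤ r := fun j => (hr j).le
  have hev : ∀ᶠ s : ℝ in nhds 0, ∀ j, Integrable (M.weight j (x + s • r)) (M.markLaw j) :=
    Filter.eventually_all.2 fun j => exists_integrable_weight_add (hopen j) (hi j) r
  have hcont : ∀ j, Filter.Tendsto
      (fun s : ℝ => z j * ∫ b, M.form j r b * M.weight j (x + s • r) b ∂(M.markLaw j))
      (nhds 0) (nhds (c * r j)) := by
    intro j
    obtain ⟨ε, h1, h2⟩ := ((hev.filter_mono nhdsWithin_le_nhds).and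
        (self_mem_nhdsWithin (s := Set.Ioi (0 : ℝ)))).exists
    have h3 := (continuousAt_integral_form_mul_weight hr0 h2 (h1 j)).tendsto.const_mul (z j)
    rwa [zero_smul, add_zero, integral_form_mul_weight fun k => hcoeff k j, heig' j] at h3
  -- upper bound for the increment of the fixed-point map by the derivative at the far end
  have hinc : ∀ s : ℝ, (∀ j, Integrable (M.weight j (x + s • r)) (M.markLaw j)) → ∀ j,
      Integrable (fun b => M.form j r b * M.weight j (x + s • r) b) (M.markLaw j) →
      z j * ∫ b, M.weight j (x + s • r) b ∂(M.markLaw j) ≤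
        x j + s * (z j * ∫ b, M.form j r b * M.weight j (x + s • r) b ∂(M.markLaw j)) := by
    intro s hs j hf
    have h1 : ∫ b, M.weight j (x + s • r) b ∂(M.markLaw j) ≤ ∫ b, M.weight j x b ∂(M.markLaw j) +
        s * ∫ b, M.form j r b * M.weight j (x + s • r) b ∂(M.markLaw j) := by
      rw [← integral_const_mul, ← integral_add (hi j) (hf.const_mul s)]
      refine integral_mono (hs j) ((hi j).add (hf.const_mul s)) fun b => ?_
      have h2 := tangent_le_weight (M := M) j (x + s • r) x b
      have h3 : x - (x + s • r) = (-s) • r := by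
        rw [neg_smul]; abel
      rw [h3, form_smul] at h2
      simp only
      linarith
    have h4 := mul_le_mul_of_nonneg_left h1 (hz j).le
    rw [hfix j]
    linarith
  have hfint : ∀ᶠ s : ℝ in nhds 0, ∀ j,
      Integrable (fun b => M.form j r b * M.weight j (x + s • r) b) (M.markLaw j) := by
    obtain ⟨ε, h1, h2⟩ := ((hev.filter_mono nhdsWithin_le_nhds).and
        (self_mem_nhdsWithin (s := Set.Ioi (0 : ℝ)))).exists
    have hε : (0 : ℝ) < ε := h2
    filter_upwards [eventually_lt_nhds hε] with s hs j
    have hle : x + s • r ≤ x + ε • r := fun m => by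
      have := mul_le_mul_of_nonneg_right hs.le (hr0 m)
      simpa using this
    have h3 := integrable_form_mul_weight j hle (h1 j)
    have h4 : x + ε • r - (x + s • r) = (ε - s) • r := by
      rw [sub_smul]; abel
    simp_rw [h4, form_smul, mul_assoc] at h3
    have := h3.const_mul (ε - s)⁻¹
    simpa only [inv_mul_cancel_left₀ (sub_pos.2 hs).ne'] using this
  rcases lt_trichotomy c 1 with hc | hc | hc
  · left
    have h1 : ∀ᶠ s : ℝ in nhds 0, ∀ j,
        z j * ∫ b, M.form j r b * M.weight j (x + s • r) b ∂(M.markLaw j) < r j :=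
      Filter.eventually_all.2 fun j =>
        (hcont j).eventually_lt_const (by nlinarith [hr j])
    obtain ⟨s, ⟨⟨h2, h3⟩, h4⟩, h5⟩ := (((hev.and hfint).and h1).filter_mono
      nhdsWithin_le_nhds |>.and (self_mem_nhdsWithin (s := Set.Ioi (0 : ℝ)))).exists
    have hs : (0 : ℝ) < s := h5
    have hstrict : ∀ j, z j * ∫ b, M.weight j (x + s • r) b ∂(M.markLaw j) < (x + s • r) j := by
      intro j
      have := hinc s h2 j (h3 j)
      have := mul_lt_mul_of_pos_left (h4 j) hs
      simp only [Pi.add_apply, Pi.smul_apply, smul_eq_mul]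
      linarith
    rw [mem_interior_iff_mem_nhds]
    have hnear : ∀ᶠ z' in nhds z, ∀ j, 0 < z' j ∧
        z' j * ∫ b, M.weight j (x + s • r) b ∂(M.markLaw j) < (x + s • r) j := by
      refine Filter.eventually_all.2 fun j => ?_
      have ht : Filter.Tendsto (fun z' : Fin d → ℝ => z' j) (nhds z) (nhds (z j)) :=
        (continuous_apply j).tendsto z
      exact (ht.eventually_const_lt (hz j)).and ((ht.mul_const _).eventually_lt_const (hstrict j))
    filter_upwards [hnear] with z' hz'
    exact (mem_domain_of_supersolution (fun j => (hz' j).1.le)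
      (add_nonneg (sol_nonneg z) (smul_nonneg hs.le hr0)) h2 fun j => (hz' j).2.le).1
  · right
    exact ⟨r, hr, hz, hi, hcoeff, fun j => (hfix j).symm, fun j => by rw [heig', hc, one_mul]⟩
  · exfalso
    have h1 : ∀ᶠ s : ℝ in nhds 0, ∀ j,
        r j < z j * ∫ b, M.form j r b * M.weight j (x + s • r) b ∂(M.markLaw j) :=
      Filter.eventually_all.2 fun j =>
        (hcont j).eventually_const_lt (by nlinarith [hr j])
    have h1' : ∀ᶠ s : ℝ in nhds 0, ∀ j, 0 < (x + s • r) j := by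
      refine Filter.eventually_all.2 fun j => ?_
      have ht : Filter.Tendsto (fun s : ℝ => (x + s • r) j) (nhds 0) (nhds (x j + 0 * r j)) :=
        (continuous_const.add (continuous_id.mul continuous_const)).tendsto 0
      rw [zero_mul, add_zero] at ht
      exact ht.eventually_const_lt (hxpos j)
    obtain ⟨s, ⟨⟨⟨h2, h3⟩, h4⟩, h6⟩, h5⟩ := ((((hev.and hfint).and h1).and h1').filter_mono
      nhdsWithin_le_nhds |>.and (self_mem_nhdsWithin (s := Set.Iio (0 : ℝ)))).exists
    have hs : s < 0 := h5
    have hsuper : ∀ j, z j * ∫ b, M.weight j (x + s • r) b ∂(M.markLaw j) ≤ (x + s • r) j := by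
      intro j
      have := hinc s h2 j (h3 j)
      have := mul_lt_mul_of_neg_left (h4 j) hs
      simp only [Pi.add_apply, Pi.smul_apply, smul_eq_mul]
      linarith
    have h7 := (mem_domain_of_supersolution hD.1 (fun j => (h6 j).le) h2 hsuper).2
    obtain ⟨j⟩ := ‹Nonempty (Fin d)›
    have h8 := h7 j
    simp only [Pi.add_apply, Pi.smul_apply, smul_eq_mul, ← hx] at h8
    nlinarith [hr j]

/-! ### Boundedness of solutions and closedness of the domain -/

/-- Quadratic lower bound for the mean weight of an event in component `j` that may have children
in component `k`; for solutions it reads `x_j ≥ a z_j x_k ^ 2`. -/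
theorem exists_quadratic_bound {k j : Fin d} (hkj : 0 < M.H k j) :
    ∃ a : ℝ, 0 < a ∧ ∀ x : Fin d → ℝ, 0 ≤ x → Integrable (M.weight j x) (M.markLaw j) →
      a * x k ^ 2 ≤ ∫ b, M.weight j x b ∂(M.markLaw j) := by
  have := M.markLaw_prob j
  have hle : ∀ (y : Fin d → ℝ), 0 ≤ y → ∀ b : Fin d → ℝ≥0,
      (b k : ℝ) * M.c k j * y k ≤ M.form j y b := fun y hy b =>
    Finset.single_le_sum (f := fun m => (b m : ℝ) * M.c m j * y m)
      (fun m _ => mul_nonneg (coeff_nonneg b m j) (hy m)) (Finset.mem_univ k)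
  have hpt : ∀ x : Fin d → ℝ, 0 ≤ x → ∀ b : Fin d → ℝ≥0,
      ((b k : ℝ) * M.c k j) ^ 2 / 2 * M.weight j 0 b * x k ^ 2 ≤ M.weight j x b := by
    intro x hx b
    rw [← weight_mul_exp j 0 x, sub_zero]
    have h1 := hle x hx b
    have h0 : 0 ≤ (b k : ℝ) * M.c k j * x k := mul_nonneg (coeff_nonneg b k j) (hx k)
    have h2 := Real.quadratic_le_exp_of_nonneg h0
    have h3 := Real.exp_le_exp.2 h1
    have h4 : ((b k : ℝ) * M.c k j) ^ 2 / 2 * x k ^ 2 ≤ Real.exp (M.form j x b) := by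
      have : ((b k : ℝ) * M.c k j * x k) ^ 2 / 2 = ((b k : ℝ) * M.c k j) ^ 2 / 2 * x k ^ 2 := by
        ring
      linarith
    have := mul_le_mul_of_nonneg_left h4 (weight_pos (M := M) j 0 b).le
    linarith
  have hint : Integrable (fun b => ((b k : ℝ) * M.c k j) ^ 2 / 2 * M.weight j 0 b)
      (M.markLaw j) := by
    refine (integrable_const (1 : ℝ)).mono' (Measurable.aestronglyMeasurable ?_)
      (Filter.Eventually.of_forall fun b => ?_)
    · have := measurable_weight (M := M) j 0
      have h1 : Measurable fun b : Fin d → ℝ≥0 => (b k : ℝ) :=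
        measurable_coe_nnreal_real.comp (measurable_pi_apply k)
      fun_prop
    · rw [Real.norm_of_nonneg (mul_nonneg (by positivity) (weight_pos j 0 b).le)]
      have h1 := hpt 1 (fun _ => zero_le_one) b
      have h2 : M.weight j 1 b = 1 := by simp [weight]
      rw [h2] at h1
      simpa using h1
  refine ⟨∫ b, ((b k : ℝ) * M.c k j) ^ 2 / 2 * M.weight j 0 b ∂(M.markLaw j), ?_, ?_⟩
  · have h0 : ∀ b : Fin d → ℝ≥0, 0 ≤ ((b k : ℝ) * M.c k j) ^ 2 / 2 * M.weight j 0 b := fun b =>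
      mul_nonneg (by positivity) (weight_pos j 0 b).le
    refine lt_of_le_of_ne (integral_nonneg h0) fun h => hkj.ne' ?_
    have h1 := (integral_eq_zero_iff_of_nonneg h0 hint).1 h.symm
    rw [H, ← integral_mul_const]
    refine integral_eq_zero_of_ae ?_
    filter_upwards [h1] with b hb
    have := (mul_eq_zero.1 hb).resolve_right (weight_pos j 0 b).ne'
    simpa using this
  · intro x hx hi
    rw [← integral_mul_const]
    exact integral_mono (hint.mul_const _) hi fun b => hpt x hx b

/-- Under irreducibility, solutions are bounded in terms of a lower bound for the parameter: the
largest coordinate `x_l` satisfies `x_l ≥ x_j ≥ a δ x_l ^ 2` for a suitable `j`. -/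
theorem exists_sol_bound (hirr : M.H.IsIrreducible) :
    ∃ a : ℝ, 0 < a ∧ ∀ (δ : ℝ) (z : Fin d → ℝ), 0 < δ → (∀ j, δ ≤ z j) → z ∈ M.domain →
      ∀ k, a * δ * M.sol z k ≤ 1 := by
  rcases isEmpty_or_nonempty (Fin d) with hd | hd
  · exact ⟨1, one_pos, fun _ _ _ _ _ k => hd.elim k⟩
  choose j hj using exists_pos_of_isIrreducible hirr
  choose a ha hbound using fun k => exists_quadratic_bound (hj k)
  obtain ⟨k0, hk0⟩ := Finite.exists_min a
  refine ⟨a k0, ha k0, fun δ z hδ hz hD k => ?_⟩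
  obtain ⟨l, hl⟩ := Finite.exists_max (M.sol z)
  have hzpos : ∀ j, 0 < z j := fun j => hδ.trans_le (hz j)
  have hi := integrable_weight_sol hD (hzpos (j l))
  have h1 := hbound l (M.sol z) (sol_nonneg z) hi
  have h2 := sol_eq hD hi
  have h3 := hl (j l)
  have hlpos : 0 ≤ M.sol z l := sol_nonneg z l
  have h4 : a k0 * δ * M.sol z l ^ 2 ≤ M.sol z l := by
    calc a k0 * δ * M.sol z l ^ 2 ≤ a l * z (j l) * M.sol z l ^ 2 := by
          gcongr
          · exact (ha l).le
          · exact hk0 l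
          · exact hz _
      _ = z (j l) * (a l * M.sol z l ^ 2) := by ring
      _ ≤ z (j l) * ∫ b, M.weight (j l) (M.sol z) b ∂(M.markLaw (j l)) :=
          mul_le_mul_of_nonneg_left h1 (hzpos _).le
      _ ≤ M.sol z l := h2 ▸ h3
  have h5 : a k0 * δ * M.sol z l ≤ 1 := by
    rcases hlpos.eq_or_lt with h0 | h0
    · rw [← h0]; simp
    · have : (a k0 * δ * M.sol z l) * M.sol z l ≤ 1 * M.sol z l := by linarith
      exact le_of_mul_le_mul_right this h0
  exact (mul_le_mul_of_nonneg_left (hl k) (mul_pos (ha k0) hδ).le).trans h5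

/-- Under irreducibility, a positive point all of whose contractions belong to the domain belongs
to the domain: the solutions at the contractions increase to a solution. -/
theorem mem_domain_of_smul (hirr : M.H.IsIrreducible) {z : Fin d → ℝ} (hz : ∀ j, 0 < z j)
    (h : ∀ t : ℝ, 0 < t → t < 1 → t • z ∈ M.domain) : z ∈ M.domain := by
  rcases isEmpty_or_nonempty (Fin d) with hd | hd
  · exact ⟨fun j => hd.elim j, fun j => hd.elim j⟩
  obtain ⟨a, ha, hb⟩ := exists_sol_bound hirr
  obtain ⟨i, hi⟩ := Finite.exists_min z
  let t : ℕ → ℝ := fun n => 1 - 1 / ((n : ℝ) + 2)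
  have ht_pos : ∀ n, 1 / 2 ≤ t n := by
    intro n
    have h1 : 1 / ((n : ℝ) + 2) ≤ 1 / 2 := by
      apply one_div_le_one_div_of_le <;> norm_num
    simp only [t]
    linarith
  have ht_lt : ∀ n, t n < 1 := by
    intro n
    have : 0 < 1 / ((n : ℝ) + 2) := by positivity
    simp only [t]
    linarith
  have ht_mono : Monotone t := by
    intro n m hnm
    have : (n : ℝ) ≤ m := by exact_mod_cast hnm
    simp only [t]
    gcongr
  have ht_lim : Filter.Tendsto t Filter.atTop (nhds 1) := by
    have h1 := (tendsto_one_div_add_atTop_nhds_zero_nat (𝕜 := ℝ)).comp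
      (Filter.tendsto_add_atTop_nat 1)
    have h2 : Filter.Tendsto (fun n : ℕ => 1 / ((n : ℝ) + 2)) Filter.atTop (nhds 0) := by
      refine h1.congr fun n => ?_
      simp only [Function.comp, Nat.cast_add, Nat.cast_one]
      ring
    have h3 := h2.const_sub 1
    rwa [sub_zero] at h3
  have htz : ∀ n, t n • z ∈ M.domain := fun n => h (t n) (by linarith [ht_pos n]) (ht_lt n)
  have htz_pos : ∀ n j, 0 < (t n • z) j := fun n j =>
    mul_pos (by linarith [ht_pos n]) (hz j)
  set u : ℕ → Fin d → ℝ := fun n => M.sol (t n • z) with hu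
  have hu_mono : Monotone u := fun n m hnm => sol_mono
    (fun j => mul_le_mul_of_nonneg_right (ht_mono hnm) (hz j).le) (htz m)
  have hu_bdd : ∀ j, BddAbove (Set.range fun n => u n j) := by
    intro j
    refine ⟨(a * (z i / 2))⁻¹, ?_⟩
    rintro _ ⟨n, rfl⟩
    have hpos : 0 < a * (z i / 2) := mul_pos ha (half_pos (hz i))
    have h1 := hb (z i / 2) (t n • z) (half_pos (hz i)) (fun j => by
      have := mul_le_mul (ht_pos n) (hi j) (hz i).le (by linarith [ht_pos n])
      simp only [Pi.smul_apply, smul_eq_mul]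
      linarith) (htz n) j
    rw [← one_div, le_div_iff₀ hpos]
    linarith
  set x : Fin d → ℝ := fun j => ⨆ n, u n j with hx
  have hlim : ∀ j, Filter.Tendsto (fun n => u n j) Filter.atTop (nhds (x j)) := fun j =>
    tendsto_atTop_ciSup (fun n m hnm => hu_mono hnm j) (hu_bdd j)
  have hx0 : 0 ≤ x := fun j => ge_of_tendsto' (hlim j) fun n => sol_nonneg _ j
  have hui : ∀ n j, Integrable (M.weight j (u n)) (M.markLaw j) := fun n j =>
    integrable_weight_sol (htz n) (htz_pos n j)
  have hueq : ∀ n j, ∫ b, M.weight j (u n) b ∂(M.markLaw j) = u n j / (t n * z j) := by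
    intro n j
    have hne : t n * z j ≠ 0 := (htz_pos n j).ne'
    rw [eq_div_iff hne, mul_comm]
    exact (sol_eq (htz n) (hui n j)).symm
  have hlint : ∀ j, ∫⁻ b, ENNReal.ofReal (M.weight j x b) ∂(M.markLaw j) =
      ENNReal.ofReal (x j / z j) := by
    intro j
    have h1 : Filter.Tendsto
        (fun n => ∫⁻ b, ENNReal.ofReal (M.weight j (u n) b) ∂(M.markLaw j)) Filter.atTop
        (nhds (∫⁻ b, ENNReal.ofReal (M.weight j x b) ∂(M.markLaw j))) := by
      refine lintegral_tendsto_of_tendsto_of_monotone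
        (fun n => (measurable_weight j _).ennreal_ofReal.aemeasurable)
        (Filter.Eventually.of_forall fun b n m hnm =>
          ENNReal.ofReal_le_ofReal (weight_mono j (hu_mono hnm) b))
        (Filter.Eventually.of_forall fun b => ENNReal.tendsto_ofReal ?_)
      unfold weight
      refine (Real.continuous_exp.tendsto _).comp (tendsto_finsetSum _ fun m _ => ?_)
      exact ((hlim m).sub_const 1).const_mul _
    refine tendsto_nhds_unique h1 ?_
    simp_rw [fun n => lintegral_weight j (hui n j), hueq]
    refine ENNReal.tendsto_ofReal ?_
    have := (hlim j).div (ht_lim.mul_const (z j)) (by simpa using (hz j).ne')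
    rwa [one_mul] at this
  have hxi : ∀ j, Integrable (M.weight j x) (M.markLaw j) := by
    intro j
    refine ⟨(measurable_weight j _).aestronglyMeasurable, ?_⟩
    rw [hasFiniteIntegral_iff_ofReal (Filter.Eventually.of_forall fun b => (weight_pos j _ b).le),
      hlint]
    exact ENNReal.ofReal_lt_top
  refine (mem_domain_of_supersolution (fun j => (hz j).le) hx0 hxi fun j => ?_).1
  have h1 := hlint j
  rw [lintegral_weight j (hxi j), ENNReal.ofReal_eq_ofReal_iff (integral_weight_pos j (hxi j)).le
    (div_nonneg (hx0 j) (hz j).le)] at h1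
  rw [h1, mul_div_cancel₀ _ (hz j).ne']

/-- Under irreducibility, the domain is bounded along rays: the solution at `t z` is at least the
one at `z` and at most of order `1 / t`. -/
theorem bddAbove_smul_mem_domain [Nonempty (Fin d)] (hirr : M.H.IsIrreducible) {z : Fin d → ℝ}
    (hz : ∀ j, 0 < z j) (hD : z ∈ M.domain) : BddAbove {t : ℝ | t • z ∈ M.domain} := by
  obtain ⟨a, ha, hb⟩ := exists_sol_bound hirr
  obtain ⟨i, hi⟩ := Finite.exists_min z
  have hpos : 0 < M.sol z i := by
    have h1 := integrable_weight_sol hD (hz i)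
    rw [sol_eq hD h1]
    exact mul_pos (hz i) (integral_weight_pos i h1)
  refine ⟨max 1 (a * z i * M.sol z i)⁻¹, fun t ht => ?_⟩
  rcases le_total t 1 with h1 | h1
  · exact h1.trans (le_max_left _ _)
  refine le_trans ?_ (le_max_right _ _)
  have ht0 : 0 < t := by linarith
  have h2 := hb (t * z i) (t • z) (mul_pos ht0 (hz i))
    (fun j => mul_le_mul_of_nonneg_left (hi j) ht0.le) ht i
  have h3 : M.sol z i ≤ M.sol (t • z) i := sol_mono (fun j => by
    have := hz j
    simp only [Pi.smul_apply, smul_eq_mul]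
    nlinarith) ht i
  have h4 := mul_le_mul_of_nonneg_left h3 (mul_pos ha (mul_pos ht0 (hz i))).le
  rw [← one_div, le_div_iff₀ (mul_pos (mul_pos ha (hz i)) hpos)]
  linarith

theorem mem_domain_iff_exists [Nonempty (Fin d)] (hirr : M.H.IsIrreducible)
    (hopen : ∀ j, IsOpen {ϑ : Fin d → ℝ | M.MgfFinite j ϑ}) {z : Fin d → ℝ}
    (hz : ∀ j, 0 < z j) :
    z ∈ M.domain ↔ ∃ s r x, M.IsCritical s r x ∧ z ≤ s := by
  constructor
  · intro hD
    set S := {t : ℝ | t • z ∈ M.domain} with hS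
    have h1 : (1 : ℝ) ∈ S := by simpa [hS] using hD
    have hbdd : BddAbove S := bddAbove_smul_mem_domain hirr hz hD
    have hT1 : 1 ≤ sSup S := le_csSup hbdd h1
    have hTpos : ∀ j, 0 < (sSup S • z) j := fun j => mul_pos (by linarith) (hz j)
    have hT : sSup S • z ∈ M.domain := by
      refine mem_domain_of_smul hirr hTpos fun t ht0 ht1 => ?_
      obtain ⟨t', ht', hlt⟩ := exists_lt_of_lt_csSup ⟨1, h1⟩
        (show t * sSup S < sSup S by nlinarith)
      rw [smul_smul]
      exact mem_domain_of_le (smul_nonneg (by positivity) hD.1)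
        (fun j => mul_le_mul_of_nonneg_right hlt.le (hz j).le) ht'
    have hint : sSup S • z ∉ interior M.domain := by
      refine notMem_interior_of_smul fun t ht hmem => ?_
      rw [smul_smul] at hmem
      have := le_csSup hbdd hmem
      nlinarith
    obtain ⟨r, hr⟩ := (mem_interior_or_isCritical hirr hopen hTpos hT).resolve_left hint
    refine ⟨_, r, _, hr, fun j => ?_⟩
    have := hz j
    simp only [Pi.smul_apply, smul_eq_mul]
    nlinarith
  · rintro ⟨s, r, x, hs, hzs⟩
    exact (hs.mem_domain_of_le (fun j => (hz j).le) hzs).1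

theorem mem_frontier_iff_exists [Nonempty (Fin d)] (hirr : M.H.IsIrreducible)
    (hopen : ∀ j, IsOpen {ϑ : Fin d → ℝ | M.MgfFinite j ϑ}) {z : Fin d → ℝ}
    (hz : ∀ j, 0 < z j) :
    z ∈ frontier M.domain ↔ ∃ r x, M.IsCritical z r x := by
  constructor
  · rintro ⟨hcl, hint⟩
    have hD : z ∈ M.domain := by
      refine mem_domain_of_smul hirr hz fun t ht0 ht1 => ?_
      have hnear : ∀ᶠ y in nhds z, ∀ j, t * z j < y j := by
        refine Filter.eventually_all.2 fun j => ?_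
        exact ((continuous_apply j).tendsto z).eventually_const_lt (by nlinarith [hz j])
      obtain ⟨y, h1, h2⟩ := ((mem_closure_iff_frequently.1 hcl).and_eventually hnear).exists
      exact mem_domain_of_le (fun j => mul_nonneg ht0.le (hz j).le) (fun j => (h2 j).le) h1
    obtain ⟨r, hr⟩ := (mem_interior_or_isCritical hirr hopen hz hD).resolve_left hint
    exact ⟨r, _, hr⟩
  · rintro ⟨r, x, h⟩
    exact h.mem_frontier

end Model

/-! ### The generating functions of the cluster sizes -/

variable {M : Model d} {Ω : Type*} [MeasurableSpace Ω] {μ : Measure Ω} [IsProbabilityMeasure μ]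
  {C : Fin d → ClusterData d Ω}

theorem pgf_eq_minSol (hC : ∀ j, M.IsCluster μ j (C j)) (h : ∀ j, ⨆ n, M.iter 1 n j = 1)
    (z : Fin d → ℝ) (j : Fin d) : pgf μ C z j = M.minSol z j :=
  (hC j).lintegral_prod_pow_size (h j) _

end Hawkes

theorem proposition3p1 (d : ℕ) (hd : 0 < d) (M : Hawkes.Model d)
    (hstable : M.Stable)
    (hmgf : ∃ ϑ : Fin d → ℝ, (∀ m, 0 < ϑ m) ∧ ∀ j, M.MgfFinite j ϑ)
    {Ω : Type*} [MeasurableSpace Ω] (μ : Measure Ω) [IsProbabilityMeasure μ]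
    (C : Fin d → Hawkes.ClusterData d Ω) (hC : ∀ j, M.IsCluster μ j (C j)) :
    -- cluster sizes are almost surely finite
    (∀ j i, ∀ᵐ ω ∂μ, (C j).size j i ω < ⊤) ∧
    (∀ r x : Fin d → ℝ, (∀ j, 0 < r j) → M.IsXHat r x →
      -- `f` is finite, increasing and solves the fixed-point system on `0 ≤ z ≤ ẑ`
      Set.Icc 0 (M.zHat r x) ⊆ Hawkes.pgfDomain μ C ∧
      MonotoneOn (fun z j => (Hawkes.pgf μ C z j).toReal) (Set.Icc 0 (M.zHat r x)) ∧
      M.IsFixedPointOn (fun z j => (Hawkes.pgf μ C z j).toReal) (Set.Icc 0 (M.zHat r x)) ∧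
      -- it is the unique such function on `0 ≤ z < ẑ`, and on `0 ≤ z ≤ ẑ` if `H` is irreducible
      (∀ h : (Fin d → ℝ) → Fin d → ℝ,
        MonotoneOn h {z | 0 ≤ z ∧ ∀ j, z j < M.zHat r x j} →
        M.IsFixedPointOn h {z | 0 ≤ z ∧ ∀ j, z j < M.zHat r x j} →
        Set.EqOn h (fun z j => (Hawkes.pgf μ C z j).toReal)
          {z | 0 ≤ z ∧ ∀ j, z j < M.zHat r x j}) ∧
      (M.H.IsIrreducible → ∀ h : (Fin d → ℝ) → Fin d → ℝ,
        MonotoneOn h (Set.Icc 0 (M.zHat r x)) →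
        M.IsFixedPointOn h (Set.Icc 0 (M.zHat r x)) →
        Set.EqOn h (fun z j => (Hawkes.pgf μ C z j).toReal) (Set.Icc 0 (M.zHat r x))) ∧
      -- `ẑ` is a boundary point of the domain, where `f` takes the value `x̂`
      (∀ j, Hawkes.pgf μ C (M.zHat r x) j = ENNReal.ofReal (x j)) ∧
      M.zHat r x ∈ frontier (Hawkes.pgfDomain μ C) ∧
      (∀ z : Fin d → ℝ, (∀ j, M.zHat r x j < z j) → z ∉ Hawkes.pgfDomain μ C) ∧
      (M.H.IsIrreducible → ∀ z ∈ Hawkes.pgfDomain μ C, M.zHat r x ≤ z → z = M.zHat r x)) ∧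
    -- these points determine the domain inside the open orthant
    (M.H.IsIrreducible → (∀ j, IsOpen {ϑ : Fin d → ℝ | M.MgfFinite j ϑ}) →
      (∀ z : Fin d → ℝ, (∀ j, 0 < z j) →
        (z ∈ Hawkes.pgfDomain μ C ↔
          ∃ r x : Fin d → ℝ, (∀ j, 0 < r j) ∧ M.IsXHat r x ∧ z ≤ M.zHat r x)) ∧
      (∀ z : Fin d → ℝ, (∀ j, 0 < z j) →
        (z ∈ frontier (Hawkes.pgfDomain μ C) ↔
          ∃ r x : Fin d → ℝ, (∀ j, 0 < r j) ∧ M.IsXHat r x ∧ z = M.zHat r x))) := by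
  have : Nonempty (Fin d) := ⟨⟨0, hd⟩⟩
  have hone := fun j => Hawkes.Model.iSup_iter_one hstable hmgf j
  have hpgf : Hawkes.pgf μ C = M.minSol :=
    funext fun z => funext fun j => Hawkes.pgf_eq_minSol hC hone z j
  have hdom : Hawkes.pgfDomain μ C = M.domain := by
    unfold Hawkes.pgfDomain
    rw [hpgf]
    rfl
  have hsol : (fun z j => (Hawkes.pgf μ C z j).toReal) = M.sol := by
    rw [hpgf]
    rfl
  rw [hsol, hdom]
  refine ⟨fun j i => ?_, fun r x hr hx => ?_, fun hirr hopen => ⟨fun z hz => ?_, fun z hz => ?_⟩⟩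
  · filter_upwards [(hC j).ae_finite_progeny (hone j)] with ω hω
    exact (C j).size_lt_top j i hω
  · have hc := hx.isCritical hr
    refine ⟨fun z hz => (hc.mem_domain_of_le hz.1 hz.2).1,
      fun z hz z' hz' h => Hawkes.Model.sol_mono h (hc.mem_domain_of_le hz'.1 hz'.2).1,
      hc.isFixedPointOn, fun h => hc.unique_lt, fun hirr h => hc.unique_le hirr, fun j => ?_,
      hc.mem_frontier, fun z hz => hc.notMem_domain hz,
      fun hirr z hz hle => hc.eq_of_mem_domain hirr hle hz⟩
    rw [hpgf, ← ENNReal.ofReal_toReal (hc.mem_domain.1.2 j).ne]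
    exact congrArg ENNReal.ofReal (congrFun hc.sol_eq j)
  · rw [Hawkes.Model.mem_domain_iff_exists hirr hopen hz]
    constructor
    · rintro ⟨s, r, x, h, hle⟩
      exact ⟨r, x, h.r_pos, h.isXHat, h.zHat_eq ▸ hle⟩
    · rintro ⟨r, x, hr, hx, hle⟩
      exact ⟨_, r, x, hx.isCritical hr, hle⟩
  · rw [Hawkes.Model.mem_frontier_iff_exists hirr hopen hz]
    constructor
    · rintro ⟨r, x, h⟩
      exact ⟨r, x, h.r_pos, h.isXHat, h.zHat_eq.symm⟩
    · rintro ⟨r, x, hr, hx, rfl⟩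
      exact ⟨r, x, hx.isCritical hr⟩
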